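/- **Definitions.** Operads are planar, single-coloured and in sets. Let $\mathfrak S$ be the operad of symmetric groups, where $\gamma(\sigma;\sigma_1,\dots,\sigma_n)\in\mathfrak S_{k_1+\dots+k_n}$ applies $\sigma_i$ inside the $i$-th block and then permutes the blocks by $\sigma$. A *group operad* is an operad $\mathcal G$ with a group structure on each $\mathcal G(n)$ (unit $e_n$) and a map of operads $\mathcal G\to\mathfrak S$ that is levelwise a group homomorphism, such that $$\gamma(xy;x_1y_1,\dots,x_ny_n)=\gamma(x;x_{y^{-1}(1)},\dots,x_{y^{-1}(n)})\,\gamma(y;y_1,\dots,y_n).$$ Maps of group operads are maps of operads over $\mathfrak S$ that are levelwise group homomorphisms; they form the category $\mathbf{GrpOp}$. Let $\nabla$ be the category with objects $\langle\!\langle n\rangle\!\rangle=\{-\infty<1<\dots<n<\infty\}$, $n\ge 0$, and morphisms the order-preserving maps fixing $\pm\infty$. For $\varphi:\langle\!\langle m\rangle\!\rangle\to\langle\!\langle n\rangle\!\rangle$ put $k^{(\varphi)}_j=\#\varphi^{-1}(j)$ for $1\le j\le n$ and $k^{(\varphi)}_{\pm\infty}=\#\varphi^{-1}(\pm\infty)-1$;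 these numbers determine $\varphi$. A *crossed interval group* is a presheaf $G$ on $\nabla$, $G_n=G(\langle\!\langle n\rangle\!\rangle)$, with a group structure on each $G_n$ and left actions $(x,\varphi)\mapsto\varphi^x$ of $G_n$ on $\nabla(\langle\!\langle m\rangle\!\rangle,\langle\!\langle n\rangle\!\rangle)$ such that $(\varphi\psi)^x=\varphi^x\psi^{\varphi^*(x)}$ and $\varphi^*(xy)=(\varphi^y)^*(x)\,\varphi^*(y)$. Maps of crossed interval groups are maps of presheaves that are levelwise group homomorphisms and respect the actions on morphisms; they form the category $\mathbf{CrsGrp}_\nabla$. Since $\nabla(\langle\!\langle 1\rangle\!\rangle,\langle\!\langle n\rangle\!\rangle)=\langle\!\langle n\rangle\!\rangle$, the group $G_n$ acts on $\langle\!\langle n\rangle\!\rangle$; this action preserves $\{1,\dots,n\}$, and we write $x(i)$ for it. The functor $\widehat\Psi:\mathbf{GrpOp}\to\mathbf{CrsGrp}_\nabla$ sends $\mathcal G$ to $\widehat\Psi(\mathcal G)_n=\mathcal G(n)$ with $$\varphi^*(x)=\gamma\bigl(e_3;e_{k^{(\varphi)}_{-\infty}},\gamma(x;e_{k^{(\varphi)}_1},\dots,e_{k^{(\varphi)}_n}),e_{k^{(\varphi)}_\infty}\bigr),$$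 where $x$, with image $\sigma\in\mathfrak S_n$, acts on morphisms by $k^{(\varphi^x)}_{\pm\infty}=k^{(\varphi)}_{\pm\infty}$ and $k^{(\varphi^x)}_j=k^{(\varphi)}_{\sigma^{-1}(j)}$ for $1\le j\le n$. The crossed interval group $\widehat\Psi(\mathfrak S)$ is again denoted by $\mathfrak S$; it is a crossed interval subgroup of the terminal crossed interval group $\mathfrak W_\nabla$, and $G$ *lies over* $\mathfrak S$ if there is a (necessarily unique) map $G\to\mathfrak S$ of crossed interval groups. A morphism $\rho:\langle\!\langle n\rangle\!\rangle\to\langle\!\langle k\rangle\!\rangle$ is *inert* if it restricts to a bijection $\rho^{-1}\{1,\dots,k\}\to\{1,\dots,k\}$. Morphisms $\varphi_1,\varphi_2$ with domain $\langle\!\langle n\rangle\!\rangle$ are *dissociated* if for every $\alpha:\langle\!\langle 1\rangle\!\rangle\to\langle\!\langle n\rangle\!\rangle$ one of $\varphi_1\alpha,\varphi_2\alpha$ factors through $\langle\!\langle 0\rangle\!\rangle$. $G$ is *operadic* if (i) $\rho^x=\rho$ for every inert $\rho:\langle\!\langle n\rangle\!\rangle\to\langle\!\langle k\rangle\!\rangle$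 and $x\in G_k$, and (ii) for dissociated inert morphisms $\rho_1,\rho_2$ with the same domain, the elements of the image of $\rho_1^*$ commute with those of the image of $\rho_2^*$. For $\vec k=(k_1,\dots,k_n)$ and $m=k_1+\dots+k_n$, let $\mu_{\vec k}:\langle\!\langle m\rangle\!\rangle\to\langle\!\langle n\rangle\!\rangle$ be the morphism with $k^{(\mu_{\vec k})}_j=k_j$ for $1\le j\le n$ and $k^{(\mu_{\vec k})}_{\pm\infty}=0$, and let $\rho^{(\vec k)}_j:\langle\!\langle m\rangle\!\rangle\to\langle\!\langle k_j\rangle\!\rangle$ be the inert morphism that maps the $j$-th block $\{k_1+\dots+k_{j-1}+1,\dots,k_1+\dots+k_j\}$ to $\{1,\dots,k_j\}$ by the order isomorphism, everything below it to $-\infty$ and everything above it to $\infty$. $G$ is *tame* if for all $\vec k$, $x\in G_n$, $1\le i\le n$ and $x_i\in G_{k_i}$, $$\mu_{\vec k}^*(x)\cdot(\rho^{(\vec k)}_i)^*(x_i)=(\rho^{(x_*\vec k)}_{x(i)})^*(x_i)\cdot\mu_{\vec k}^*(x),\qquad x_*\vec k=(k_{x^{-1}(1)},\dots,k_{x^{-1}(n)}).$$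 **Theorem.** Let $G$ be a crossed interval group. Then $G$ belongs to the essential image of $\widehat\Psi:\mathbf{GrpOp}\to\mathbf{CrsGrp}_\nabla$ if and only if $G$ is operadic, tame and lies over $\mathfrak S$. Moreover, in this case the composition $$\gamma(x;x_1,\dots,x_n)=\mu_{\vec k}^*(x)\cdot(\rho^{(\vec k)}_1)^*(x_1)\cdots(\rho^{(\vec k)}_n)^*(x_n)$$ makes the groups $G_n$ into a group operad $\mathcal O_G$ with $\widehat\Psi(\mathcal O_G)\cong G$: there are a group operad $\mathcal O$ and an isomorphism $\widehat\Psi(\mathcal O)\cong G$ under which the composition of $\mathcal O$ corresponds to this formula. -/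

import Mathlib

open CategoryTheory

namespace IntervalGroups

universe u u' v w

/-! ## Blocks of a partition of `{1, …, m}` -/

/-- The identification `⟨k₁⟩ ⋆ ⋯ ⋆ ⟨kₙ⟩ ≅ ⟨m⟩` for `k₁ + ⋯ + kₙ = m`
(concatenation of linearly ordered blocks). -/
def blkEquiv {n m : ℕ} (k : Fin n → ℕ) (h : ∑ i, k i = m) : (Σ i, Fin (k i)) ≃ Fin m :=
  finSigmaFinEquiv.trans (finCongr h)

/-- The position in `⟨m⟩` of the `s`-th element of the `i`-th block. -/
def blk {n m : ℕ} (k : Fin n → ℕ) (h : ∑ i, k i = m) (i : Fin n) (s : Fin (k i)) : Fin m :=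
  blkEquiv k h ⟨i, s⟩

theorem blk_val {n m : ℕ} (k : Fin n → ℕ) (h : ∑ i, k i = m) (i : Fin n) (s : Fin (k i)) :
    (blk k h i s : ℕ) = ∑ j ∈ Finset.univ.filter (· < i), k j + s := by
  subst h
  simp only [blk, blkEquiv, finCongr_refl, Equiv.trans_apply, Equiv.refl_apply,
    finSigmaFinEquiv_apply]
  congr 1
  refine Finset.sum_bij (fun a _ => Fin.castLE i.2.le a) ?_ ?_ ?_ ?_
  · intro a _
    exact Finset.mem_filter.2 ⟨Finset.mem_univ _, a.2⟩
  · intro a _ b _ hab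
    simpa [Fin.ext_iff] using hab
  · intro b hb
    simp only [Finset.mem_filter, Finset.mem_univ, true_and, Fin.lt_def] at hb
    exact ⟨⟨b, hb⟩, by simp, by simp⟩
  · intro a _
    rfl

theorem blk_surj {n m : ℕ} (k : Fin n → ℕ) (h : ∑ i, k i = m) (p : Fin m) :
    ∃ i s, blk k h i s = p := by
  obtain ⟨⟨i, s⟩, rfl⟩ := (blkEquiv k h).surjective p
  exact ⟨i, s, rfl⟩

theorem blk_lt_iff {n m : ℕ} (k : Fin n → ℕ) (h : ∑ i, k i = m) (i j : Fin n)
    (s : Fin (k i)) (t : Fin (k j)) :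
    blk k h i s < blk k h j t ↔ i < j ∨ (i = j ∧ (s : ℕ) < t) := by
  have key : ∀ (i j : Fin n) (s : Fin (k i)) (t : Fin (k j)), i < j →
      blk k h i s < blk k h j t := by
    intro i j s t hij
    rw [Fin.lt_def, blk_val, blk_val]
    have : ∑ x ∈ Finset.univ.filter (· < i), k x + k i ≤
        ∑ x ∈ Finset.univ.filter (· < j), k x := by
      rw [add_comm, ← Finset.sum_insert (by simp)]
      refine Finset.sum_le_sum_of_subset ?_
      intro x hx
      simp only [Finset.mem_insert, Finset.mem_filter, Finset.mem_univ, true_and] at hx ⊢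
      rcases hx with rfl | hx
      · exact hij
      · exact hx.trans hij
    have := s.2
    omega
  rcases lt_trichotomy i j with hij | rfl | hij
  · simp [hij, key i j s t hij]
  · rw [Fin.lt_def, blk_val, blk_val]
    simp
  · have := key j i t s hij
    simp [hij.not_gt, hij.ne', this.le]

theorem sum_perm {n m : ℕ} {k : Fin n → ℕ} (h : ∑ i, k i = m) (σ : Equiv.Perm (Fin n)) :
    ∑ i, k (σ⁻¹ i) = m := by
  rw [← h]
  exact Equiv.sum_comp σ⁻¹ k

/-! ## Planar operads in sets -/

/-- A planar, single-coloured operad in sets. The composition is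
`γ : 𝒪(n) × 𝒪(k₁) × ⋯ × 𝒪(kₙ) → 𝒪(k₁ + ⋯ + kₙ)`, where the name `m` of the number
`k₁ + ⋯ + kₙ` is part of the input, so that no transport along equalities of natural numbers
is needed. Associativity reads
`γ(γ(x; y₁, …, yₙ); z₁, …, z_m) = γ(x; γ(y₁; z₁, …, z_{k₁}), …, γ(yₙ; …, z_m))`. -/
structure Operad where
  obj : ℕ → Type u
  one : obj 1
  comp {n m : ℕ} (k : Fin n → ℕ) (h : ∑ i, k i = m) (x : obj n) (y : ∀ i, obj (k i)) : obj m
  one_comp {m : ℕ} (x : obj m) : comp (fun _ : Fin 1 => m) (by simp) one (fun _ => x) = x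
  comp_one {n : ℕ} (x : obj n) : comp (fun _ : Fin n => 1) (by simp) x (fun _ => one) = x
  assoc {n m r : ℕ} (k : Fin n → ℕ) (h : ∑ i, k i = m) (l : Fin m → ℕ) (h' : ∑ p, l p = r)
    (h'' : ∑ i, ∑ s, l (blk k h i s) = r)
    (x : obj n) (y : ∀ i, obj (k i)) (z : ∀ p, obj (l p)) :
    comp l h' (comp k h x y) z =
      comp (fun i => ∑ s, l (blk k h i s)) h'' x
        (fun i => comp (fun s => l (blk k h i s)) rfl (y i) (fun s => z (blk k h i s)))

/-- Maps of operads. -/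
structure Operad.Hom (X : Operad.{u}) (Y : Operad.{v}) where
  app (n : ℕ) : X.obj n → Y.obj n
  app_one : app 1 X.one = Y.one
  app_comp {n m : ℕ} (k : Fin n → ℕ) (h : ∑ i, k i = m) (x : X.obj n) (y : ∀ i, X.obj (k i)) :
    app m (X.comp k h x y) = Y.comp k h (app n x) (fun i => app (k i) (y i))

/-! ## The operad of symmetric groups -/

/-- The permutation `γ(σ; σ₁, …, σₙ)` of `⟨m⟩`: first each `σᵢ` acts on the `i`-th block of
`⟨k₁⟩ ⋆ ⋯ ⋆ ⟨kₙ⟩`, then the blocks are permuted by `σ`, giving an element of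
`⟨k_{σ⁻¹(1)}⟩ ⋆ ⋯ ⋆ ⟨k_{σ⁻¹(n)}⟩`. -/
def permComp {n m : ℕ} (k : Fin n → ℕ) (h : ∑ i, k i = m) (σ : Equiv.Perm (Fin n))
    (τ : ∀ i, Equiv.Perm (Fin (k i))) : Equiv.Perm (Fin m) :=
  (blkEquiv k h).symm.trans
    ((Equiv.sigmaCongr (β₂ := fun j => Fin (k (σ⁻¹ j))) σ
      (fun i => (τ i).trans (finCongr (by simp)))).trans
      (blkEquiv (fun j => k (σ⁻¹ j)) (sum_perm h σ)))

theorem permComp_blk {n m : ℕ} (k : Fin n → ℕ) (h : ∑ i, k i = m) (σ : Equiv.Perm (Fin n))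
    (τ : ∀ i, Equiv.Perm (Fin (k i))) (i : Fin n) (s : Fin (k i)) :
    permComp k h σ τ (blk k h i s) =
      blk (fun j => k (σ⁻¹ j)) (sum_perm h σ) (σ i) (Fin.cast (by simp) (τ i s)) := by
  simp [permComp, blk, Equiv.sigmaCongr, Equiv.sigmaCongrLeft]

theorem permComp_val {n m : ℕ} (k : Fin n → ℕ) (h : ∑ i, k i = m) (σ : Equiv.Perm (Fin n))
    (τ : ∀ i, Equiv.Perm (Fin (k i))) (i : Fin n) (s : Fin (k i)) :
    (permComp k h σ τ (blk k h i s) : ℕ) =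
      ∑ j ∈ Finset.univ.filter (fun j => σ j < σ i), k j + τ i s := by
  rw [permComp_blk, blk_val, Fin.val_cast]
  congr 1
  refine Finset.sum_bij (fun a _ => σ⁻¹ a) ?_ ?_ ?_ ?_ <;> simp
  intro b hb
  exact ⟨σ b, hb, by simp⟩

theorem permComp_lt_iff {n m : ℕ} (k : Fin n → ℕ) (h : ∑ i, k i = m) (σ : Equiv.Perm (Fin n))
    (τ : ∀ i, Equiv.Perm (Fin (k i))) (i j : Fin n) (s : Fin (k i)) (t : Fin (k j)) :
    permComp k h σ τ (blk k h i s) < permComp k h σ τ (blk k h j t) ↔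
      σ i < σ j ∨ (i = j ∧ (τ i s : ℕ) < τ j t) := by
  rw [permComp_blk, permComp_blk, blk_lt_iff]
  simp

theorem blk_blk {n m r : ℕ} (k : Fin n → ℕ) (h : ∑ i, k i = m) (l : Fin m → ℕ)
    (h' : ∑ p, l p = r) (h'' : ∑ i, ∑ s, l (blk k h i s) = r) (i : Fin n) (s : Fin (k i))
    (t : Fin (l (blk k h i s))) :
    blk (fun i => ∑ s, l (blk k h i s)) h'' i (blk (fun s => l (blk k h i s)) rfl s t) =
      blk l h' (blk k h i s) t := by
  apply Fin.ext
  simp only [blk_val]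
  rw [← add_assoc]
  congr 1
  rw [Finset.sum_filter, Finset.sum_filter, Finset.sum_filter]
  have : ∀ f : Fin m → ℕ, ∑ p, f p = ∑ i, ∑ s, f (blk k h i s) := by
    intro f
    rw [← Equiv.sum_comp (blkEquiv k h), Fintype.sum_sigma]
    rfl
  rw [this]
  simp only [blk_lt_iff]
  have h1 : ∀ i', (∑ s' : Fin (k i'), if i' < i ∨ i' = i ∧ (s' : ℕ) < s then l (blk k h i' s') else 0) =
      (if i' < i then ∑ s', l (blk k h i' s') else 0) +
      (if i' = i then ∑ s' : Fin (k i'), if (s' : ℕ) < s then l (blk k h i' s') else 0 else 0) := by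
    intro i'
    rcases lt_trichotomy i' i with hi | rfl | hi
    · simp [hi, hi.ne]
    · simp
    · simp [hi.not_gt, hi.ne']
  rw [Finset.sum_congr rfl (fun i' _ => h1 i'), Finset.sum_add_distrib]
  simp

theorem permComp_assoc {n m r : ℕ} (k : Fin n → ℕ) (h : ∑ i, k i = m) (l : Fin m → ℕ)
    (h' : ∑ p, l p = r) (h'' : ∑ i, ∑ s, l (blk k h i s) = r)
    (x : Equiv.Perm (Fin n)) (y : ∀ i, Equiv.Perm (Fin (k i)))
    (z : ∀ p, Equiv.Perm (Fin (l p))) :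
    permComp l h' (permComp k h x y) z =
      permComp (fun i => ∑ s, l (blk k h i s)) h'' x
        (fun i => permComp (fun s => l (blk k h i s)) rfl (y i) (fun s => z (blk k h i s))) := by
  apply Equiv.ext
  intro p
  obtain ⟨q, t, rfl⟩ := blk_surj l h' p
  obtain ⟨i, s, rfl⟩ := blk_surj k h q
  apply Fin.ext
  rw [permComp_val, ← blk_blk k h l h' h'', permComp_val, permComp_val, ← add_assoc]
  congr 1
  rw [Finset.sum_filter, Finset.sum_filter, Finset.sum_filter]
  have : ∀ f : Fin m → ℕ, ∑ p, f p = ∑ i, ∑ s, f (blk k h i s) := by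
    intro f
    rw [← Equiv.sum_comp (blkEquiv k h), Fintype.sum_sigma]
    rfl
  rw [this]
  simp only [permComp_lt_iff]
  have h1 : ∀ i', (∑ s' : Fin (k i'), if x i' < x i ∨ i' = i ∧ (y i' s' : ℕ) < y i s
        then l (blk k h i' s') else 0) =
      (if x i' < x i then ∑ s', l (blk k h i' s') else 0) +
      (if i' = i then ∑ s' : Fin (k i'), if (y i' s' : ℕ) < y i s
        then l (blk k h i' s') else 0 else 0) := by
    intro i'
    by_cases hi : i' = i
    · subst hi; simp
    · simp [hi]
  rw [Finset.sum_congr rfl (fun i' _ => h1 i'), Finset.sum_add_distrib]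
  simp

theorem permComp_mul {n m : ℕ} (k : Fin n → ℕ) (h : ∑ i, k i = m)
    (x y : Equiv.Perm (Fin n)) (xs ys : ∀ i, Equiv.Perm (Fin (k i))) :
    permComp k h (x * y) (fun i => xs i * ys i) =
      permComp (fun i => k (y⁻¹ i)) (sum_perm h y) x (fun i => xs (y⁻¹ i)) *
        permComp k h y ys := by
  apply Equiv.ext
  intro p
  obtain ⟨i, s, rfl⟩ := blk_surj k h p
  rw [Equiv.Perm.mul_apply]
  apply Fin.ext
  rw [permComp_val, permComp_blk, permComp_val]
  congr 1
  · refine Finset.sum_bij (fun a _ => y a) ?_ ?_ ?_ ?_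
    · intro a ha
      exact Finset.mem_filter.2 ⟨Finset.mem_univ _, by simpa using (Finset.mem_filter.1 ha).2⟩
    · intro a _ b _ hab; simpa using hab
    · intro b hb
      have hb := (Finset.mem_filter.1 hb).2
      exact ⟨y.symm b, Finset.mem_filter.2 ⟨Finset.mem_univ _, by simpa using hb⟩, by simp⟩
    · intro a _; simp
  · have aux : ∀ (j : Fin n) (hj : j = i) (h1 : k i = k j),
        ((xs i (ys i s) : Fin (k i)) : ℕ) = xs j (Fin.cast h1 (ys i s)) := by
      rintro j rfl h1
      rfl
    exact aux _ (by simp) _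

/-- The operad `𝔖` of symmetric groups. -/
def symmOperad : Operad.{0} where
  obj n := Equiv.Perm (Fin n)
  one := 1
  comp k h x y := permComp k h x y
  one_comp := by
    intro m x
    apply Equiv.ext
    intro p
    obtain ⟨i, s, rfl⟩ := blk_surj (fun _ : Fin 1 => m) (by simp) p
    apply Fin.ext
    have h0 : blk (fun _ : Fin 1 => m) (by simp) i s = s := by
      apply Fin.ext; rw [blk_val]; simp [Subsingleton.elim _ i]
    rw [permComp_val, h0]
    simp
  comp_one := by
    intro n x
    apply Equiv.ext
    intro p
    obtain ⟨i, s, rfl⟩ := blk_surj (fun _ : Fin n => 1) (by simp) p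
    apply Fin.ext
    have h0 : blk (fun _ : Fin n => 1) (by simp) i s = i := by
      apply Fin.ext
      rw [blk_val]
      have : Finset.univ.filter (fun x => x < i) = Finset.Iio i := by ext; simp
      simp [Subsingleton.elim s 0, this]
    rw [permComp_val, h0]
    have : Finset.univ.filter (fun j => x j < x i) = (Finset.Iio (x i)).map x⁻¹.toEmbedding := by
      ext j; simp; rfl
    simp [this, Subsingleton.elim s 0]
  assoc := permComp_assoc

instance (n : ℕ) : Group (symmOperad.obj n) := inferInstanceAs (Group (Equiv.Perm (Fin n)))

/-! ## Group operads -/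

/-- The permutation of `⟨n⟩` underlying the image of `x` in `𝔖(n)`. -/
def Operad.Hom.perm {X : Operad.{u}} (f : Operad.Hom X symmOperad) {n : ℕ} (x : X.obj n) :
    Equiv.Perm (Fin n) :=
  f.app n x

/-- A group operad: an operad with a group structure on each `𝒢(n)` and a map of operads to `𝔖`
that is levelwise a group homomorphism, satisfying
`γ(xy; x₁y₁, …, xₙyₙ) = γ(x; x_{y⁻¹(1)}, …, x_{y⁻¹(n)}) γ(y; y₁, …, yₙ)`. -/
structure GroupOperad extends Operad.{u} where
  [group (n : ℕ) : Group (obj n)]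
  toSymm : Operad.Hom toOperad symmOperad
  toSymm_mul {n : ℕ} (x y : obj n) : toSymm.app n (x * y) = toSymm.app n x * toSymm.app n y
  interchange {n m : ℕ} (k : Fin n → ℕ) (h : ∑ i, k i = m) (x y : obj n)
    (xs ys : ∀ i, obj (k i)) :
    comp k h (x * y) (fun i => xs i * ys i) =
      comp (fun i => k ((toSymm.perm y)⁻¹ i)) (sum_perm h (toSymm.perm y)) x
        (fun i => xs ((toSymm.perm y)⁻¹ i)) * comp k h y ys

attribute [instance] GroupOperad.group

namespace GroupOperad

/-- Maps of group operads: maps of operads over `𝔖` that are levelwise group homomorphisms. -/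
@[ext]
structure Hom (X : GroupOperad.{u}) (Y : GroupOperad.{v}) where
  toHom : Operad.Hom X.toOperad Y.toOperad
  app_mul {n : ℕ} (x y : X.obj n) : toHom.app n (x * y) = toHom.app n x * toHom.app n y
  app_toSymm {n : ℕ} (x : X.obj n) : Y.toSymm.app n (toHom.app n x) = X.toSymm.app n x

/-- The category of group operads. -/
instance : Category GroupOperad.{u} where
  Hom X Y := Hom X Y
  id X :=
    { toHom := { app := fun _ x => x, app_one := rfl, app_comp := fun _ _ _ _ => rfl }
      app_mul := fun _ _ => rfl
      app_toSymm := fun _ => rfl }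
  comp f g :=
    { toHom :=
        { app := fun n x => g.toHom.app n (f.toHom.app n x)
          app_one := by rw [f.toHom.app_one, g.toHom.app_one]
          app_comp := fun k h x y => by rw [f.toHom.app_comp, g.toHom.app_comp] }
      app_mul := fun x y => by simp only [f.app_mul, g.app_mul]
      app_toSymm := fun x => by simp only [g.app_toSymm, f.app_toSymm] }

/-- The action of `𝒢(n)` on `⟨n⟩`. -/
def perm (X : GroupOperad.{u}) {n : ℕ} : X.obj n →* Equiv.Perm (Fin n) :=
  MonoidHom.mk' X.toSymm.perm X.toSymm_mul

/-- The operad `𝔖` as a group operad, with the identity as structure map. -/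
def symm : GroupOperad.{0} where
  toOperad := symmOperad
  toSymm := { app := fun _ x => x, app_one := rfl, app_comp := fun _ _ _ _ => rfl }
  toSymm_mul _ _ := rfl
  interchange k h x y xs ys := permComp_mul k h x y xs ys

end GroupOperad

/-! ## Crossed groups -/

/-- A crossed `A`-group: a presheaf on `A` with a group structure on each `G(a)` and a left action
`(x, φ) ↦ φˣ` of `G(a)` on each hom-set `A(b, a)` such that `(φψ)ˣ = φˣ ψ^{φ*(x)}` and
`φ*(xy) = (φʸ)*(x) φ*(y)`. -/
structure CrossedGroup (A : Type v) [Category.{w} A] where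
  obj : A → Type u
  [group (a : A) : Group (obj a)]
  map {a b : A} (φ : b ⟶ a) : obj a → obj b
  map_id {a : A} (x : obj a) : map (𝟙 a) x = x
  map_comp {a b c : A} (ψ : c ⟶ b) (φ : b ⟶ a) (x : obj a) : map (ψ ≫ φ) x = map ψ (map φ x)
  act {a b : A} (x : obj a) (φ : b ⟶ a) : b ⟶ a
  one_act {a b : A} (φ : b ⟶ a) : act (1 : obj a) φ = φ
  mul_act {a b : A} (x y : obj a) (φ : b ⟶ a) : act (x * y) φ = act x (act y φ)
  comp_act {a b c : A} (ψ : c ⟶ b) (φ : b ⟶ a) (x : obj a) :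
    act x (ψ ≫ φ) = act (map φ x) ψ ≫ act x φ
  map_mul {a b : A} (φ : b ⟶ a) (x y : obj a) : map φ (x * y) = map (act y φ) x * map φ y

attribute [instance] CrossedGroup.group

namespace CrossedGroup

/-- Maps of crossed `A`-groups. -/
@[ext]
structure Hom {A : Type v} [Category.{w} A] (G : CrossedGroup.{u} A) (H : CrossedGroup.{u'} A) where
  app (a : A) : G.obj a → H.obj a
  app_map {a b : A} (φ : b ⟶ a) (x : G.obj a) : app b (G.map φ x) = H.map φ (app a x)
  app_mul {a : A} (x y : G.obj a) : app a (x * y) = app a x * app a y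
  act_app {a b : A} (x : G.obj a) (φ : b ⟶ a) : H.act (app a x) φ = G.act x φ

/-- The category of crossed `A`-groups. -/
instance (A : Type v) [Category.{w} A] : Category (CrossedGroup.{u} A) where
  Hom G H := Hom G H
  id G :=
    { app := fun _ x => x
      app_map := fun _ _ => rfl
      app_mul := fun _ _ => rfl
      act_app := fun _ _ => rfl }
  comp f g :=
    { app := fun a x => g.app a (f.app a x)
      app_map := fun φ x => by rw [f.app_map, g.app_map]
      app_mul := fun x y => by rw [f.app_mul, g.app_mul]
      act_app := fun x φ => by rw [g.act_app, f.act_app] }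

end CrossedGroup

/-! ## The category of intervals -/

/-- The objects `⟪n⟫ = {-∞, 1, …, n, ∞}` of the category `∇` of intervals. -/
structure Nabla : Type where
  len : ℕ

/-- The linearly ordered set `⟪n⟫ = {-∞, 1, …, n, ∞}`, realised as `{0, 1, …, n, n + 1}`. -/
abbrev Nabla.Carrier (a : Nabla) : Type := Fin (a.len + 2)

/-- Morphisms of `∇` are the order-preserving maps with `-∞ ↦ -∞` and `∞ ↦ ∞`. -/
instance : Category Nabla where
  Hom a b := BoundedOrderHom a.Carrier b.Carrier
  id a := BoundedOrderHom.id a.Carrier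
  comp f g := BoundedOrderHom.comp g f

/-- The map of sets underlying a morphism of `∇`. -/
def Nabla.fn {a b : Nabla} (φ : a ⟶ b) : a.Carrier → b.Carrier :=
  (show BoundedOrderHom a.Carrier b.Carrier from φ)

/-- The element `i` of `⟨n⟩` as an element of `⟪n⟫`. -/
def mid {n : ℕ} (i : Fin n) : Fin (n + 2) := i.castSucc.succ

theorem mid_val {n : ℕ} (i : Fin n) : (mid i : ℕ) = i + 1 := rfl

theorem mid_cases {n : ℕ} (j : Fin (n + 2)) : j = 0 ∨ j = Fin.last (n + 1) ∨ ∃ i, j = mid i := by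
  refine Fin.cases (Or.inl rfl) (fun j => Fin.lastCases (Or.inr (Or.inl rfl))
    (fun i => Or.inr (Or.inr ⟨i, rfl⟩)) j) j

namespace Nabla

variable {a b c : Nabla}

theorem fn_mono (φ : a ⟶ b) : Monotone (fn φ) :=
  OrderHomClass.mono (show BoundedOrderHom a.Carrier b.Carrier from φ)

theorem fn_zero (φ : a ⟶ b) : fn φ 0 = 0 :=
  map_bot (show BoundedOrderHom a.Carrier b.Carrier from φ)

theorem fn_last (φ : a ⟶ b) : fn φ (Fin.last _) = Fin.last _ :=
  map_top (show BoundedOrderHom a.Carrier b.Carrier from φ)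

theorem fn_comp (φ : a ⟶ b) (ψ : b ⟶ c) (i : a.Carrier) : fn (φ ≫ ψ) i = fn ψ (fn φ i) := rfl

theorem fn_id (i : a.Carrier) : fn (𝟙 a) i = i := rfl

theorem hom_ext {φ ψ : a ⟶ b} (h : ∀ i, fn φ i = fn ψ i) : φ = ψ :=
  DFunLike.ext (F := BoundedOrderHom a.Carrier b.Carrier) _ _ h

/-- The number of preimages. -/
def card (φ : a ⟶ b) (j : b.Carrier) : ℕ := (Finset.univ.filter (fun i => fn φ i = j)).card

/-- The number of points of `⟪n⟫` that do not count: one for each of `±∞`. -/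
def bd {n : ℕ} (j : Fin (n + 2)) : ℕ := if j = 0 ∨ j = Fin.last (n + 1) then 1 else 0

/-- The vector `k^{(φ)}`: the number of preimages of `j` for `1 ≤ j ≤ n`, and that number
minus one for `j = ±∞`. -/
def vec (φ : a ⟶ b) (j : b.Carrier) : ℕ := card φ j - bd j

@[simp] theorem bd_zero {n : ℕ} : bd (0 : Fin (n + 2)) = 1 := by simp [bd]
@[simp] theorem bd_last {n : ℕ} : bd (Fin.last (n + 1)) = 1 := by simp [bd]
@[simp] theorem bd_mid {n : ℕ} (i : Fin n) : bd (mid i) = 0 := by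
  have := i.2
  simp [bd, Fin.ext_iff, mid_val]; omega

theorem sum_ends {n : ℕ} (f : Fin (n + 2) → ℕ) :
    ∑ j, f j = f 0 + ∑ i, f (mid i) + f (Fin.last (n + 1)) := by
  rw [Fin.sum_univ_succ, Fin.sum_univ_castSucc, ← add_assoc]
  rfl

theorem card_eq (φ : a ⟶ b) (j : b.Carrier) : card φ j = vec φ j + bd j := by
  have : bd j ≤ card φ j := by
    unfold bd
    split_ifs with h
    · refine Finset.card_pos.2 ?_
      rcases h with rfl | rfl
      · exact ⟨0, by simp [fn_zero]⟩
      · exact ⟨Fin.last _, by simp [fn_last]⟩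
    · exact Nat.zero_le _
  unfold vec; omega

theorem sum_card (φ : a ⟶ b) : ∑ j, card φ j = a.len + 2 := by
  have := Finset.card_eq_sum_card_fiberwise (f := fn φ) (s := Finset.univ) (t := Finset.univ)
    (fun _ _ => Finset.mem_coe.2 (Finset.mem_univ _))
  simpa [card] using this.symm

theorem sum_vec (φ : a ⟶ b) : ∑ j, vec φ j = a.len := by
  have h := sum_card φ
  rw [Finset.sum_congr rfl (fun j _ => card_eq φ j), Finset.sum_add_distrib,
    sum_ends bd] at h
  simp at h
  omega

/-- A monotone map is determined by the cardinalities of its fibres. -/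
theorem mono_ext {N M : ℕ} {f g : Fin N → Fin M} (hf : Monotone f) (hg : Monotone g)
    (h : ∀ j, (Finset.univ.filter (fun i => f i = j)).card =
      (Finset.univ.filter (fun i => g i = j)).card) : f = g := by
  have cf : ∀ (f : Fin N → Fin M) (j : Fin M), (Finset.univ.filter (fun i => f i ≤ j)).card =
      ∑ j' ∈ Finset.univ.filter (· ≤ j), (Finset.univ.filter (fun i => f i = j')).card := by
    intro f j
    rw [Finset.card_eq_sum_card_fiberwise (f := f) (t := Finset.univ.filter (· ≤ j))
      (fun i hi => by simpa using hi)]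
    refine Finset.sum_congr rfl (fun j' hj' => ?_)
    congr 1
    ext i
    simp only [Finset.mem_filter, Finset.mem_univ, true_and] at hj' ⊢
    exact ⟨fun h => h.2, fun h => ⟨h ▸ hj', h⟩⟩
  have key : ∀ j i, f i ≤ j ↔ g i ≤ j := by
    intro j i
    have hc : (Finset.univ.filter (fun i => f i ≤ j)).card =
        (Finset.univ.filter (fun i => g i ≤ j)).card := by
      rw [cf, cf]; exact Finset.sum_congr rfl (fun j' _ => h j')
    have hs : Finset.univ.filter (fun i => f i ≤ j) = Finset.univ.filter (fun i => g i ≤ j) := by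
      by_cases hsub : Finset.univ.filter (fun i => f i ≤ j) ⊆
          Finset.univ.filter (fun i => g i ≤ j)
      · exact Finset.eq_of_subset_of_card_le hsub hc.ge
      · refine (Finset.eq_of_subset_of_card_le ?_ hc.le).symm
        obtain ⟨i₀, h1, h2⟩ := Finset.not_subset.1 hsub
        simp only [Finset.mem_filter, Finset.mem_univ, true_and, not_le] at h1 h2
        intro i₁ hi
        simp only [Finset.mem_filter, Finset.mem_univ, true_and] at hi ⊢
        have : i₁ ≤ i₀ := by
          by_contra hlt
          exact absurd (hg (not_le.1 hlt).le) (not_le.2 (hi.trans_lt h2))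
        exact (hf this).trans h1
    have := Finset.ext_iff.1 hs i
    simpa using this
  funext i
  exact le_antisymm ((key _ i).2 le_rfl) ((key _ i).1 le_rfl)

theorem hom_ext_card {φ ψ : a ⟶ b} (h : ∀ j, card φ j = card ψ j) : φ = ψ :=
  hom_ext (fun i => congrFun (mono_ext (fn_mono φ) (fn_mono ψ) h) i)

theorem hom_ext_vec {φ ψ : a ⟶ b} (h : ∀ j, vec φ j = vec ψ j) : φ = ψ :=
  hom_ext_card (fun j => by rw [card_eq, card_eq, h])

theorem sum_add_bd {n m : ℕ} {k : Fin (n + 2) → ℕ} (h : ∑ j, k j = m) :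
    ∑ j, (k j + bd j) = m + 2 := by
  rw [Finset.sum_add_distrib, h, sum_ends bd]
  simp

/-- The map sending the `j`-th block to `j`. -/
def blkIdx {n m : ℕ} (k : Fin n → ℕ) (h : ∑ i, k i = m) (p : Fin m) : Fin n :=
  ((blkEquiv k h).symm p).1

theorem blkIdx_blk {n m : ℕ} (k : Fin n → ℕ) (h : ∑ i, k i = m) (i : Fin n) (s : Fin (k i)) :
    blkIdx k h (blk k h i s) = i := by
  simp [blkIdx, blk]

theorem blkIdx_mono {n m : ℕ} (k : Fin n → ℕ) (h : ∑ i, k i = m) : Monotone (blkIdx k h) := by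
  intro p q hpq
  obtain ⟨i, s, rfl⟩ := blk_surj k h p
  obtain ⟨j, t, rfl⟩ := blk_surj k h q
  rw [blkIdx_blk, blkIdx_blk]
  by_contra hlt
  exact absurd ((blk_lt_iff k h j i t s).2 (Or.inl (not_le.1 hlt))) (not_lt.2 hpq)

theorem blkIdx_card {n m : ℕ} (k : Fin n → ℕ) (h : ∑ i, k i = m) (j : Fin n) :
    (Finset.univ.filter (fun p => blkIdx k h p = j)).card = k j := by
  have : Finset.univ.filter (fun p => blkIdx k h p = j) =
      Finset.univ.image (fun s => blk k h j s) := by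
    ext p
    obtain ⟨i, s, rfl⟩ := blk_surj k h p
    simp only [Finset.mem_filter, Finset.mem_univ, true_and, blkIdx_blk, Finset.mem_image]
    constructor
    · rintro rfl; exact ⟨s, rfl⟩
    · rintro ⟨t, ht⟩
      have := congrArg (blkIdx k h) ht
      rw [blkIdx_blk, blkIdx_blk] at this
      exact this.symm
  rw [this, Finset.card_image_of_injective, Finset.card_univ, Fintype.card_fin]
  intro s t hst
  have := (blkEquiv k h).injective hst
  simpa using this

/-- The morphism `φ : ⟪m⟫ → ⟪n⟫` with `k^{(φ)} = k`, for `k = (k_{-∞}, k₁, …, kₙ, k_∞)` a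
partition of `m`. -/
def ofVec {m n : ℕ} (k : Fin (n + 2) → ℕ) (h : ∑ j, k j = m) : (⟨m⟩ : Nabla) ⟶ ⟨n⟩ :=
  show BoundedOrderHom (Fin (m + 2)) (Fin (n + 2)) from
  { toFun := blkIdx (fun j => k j + bd j) (sum_add_bd h)
    monotone' := blkIdx_mono _ _
    map_bot' := by
      obtain ⟨s⟩ : Nonempty (Fin (k 0 + bd (0 : Fin (n + 2)))) := ⟨⟨0, by simp⟩⟩
      refine le_antisymm ?_ (Fin.zero_le _)
      refine le_trans (blkIdx_mono _ _ bot_le) (blkIdx_blk _ (sum_add_bd h) _ s).le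
    map_top' := by
      obtain ⟨s⟩ : Nonempty (Fin (k (Fin.last _) + bd (Fin.last (n + 1)))) := ⟨⟨0, by simp⟩⟩
      refine le_antisymm (Fin.le_last _) ?_
      refine le_trans (blkIdx_blk _ (sum_add_bd h) _ s).ge (blkIdx_mono _ _ le_top) }

theorem card_ofVec {m n : ℕ} (k : Fin (n + 2) → ℕ) (h : ∑ j, k j = m) (j : Fin (n + 2)) :
    card (ofVec k h) j = k j + bd j :=
  blkIdx_card _ (sum_add_bd h) j

theorem vec_ofVec {m n : ℕ} (k : Fin (n + 2) → ℕ) (h : ∑ j, k j = m) (j : Fin (n + 2)) :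
    vec (ofVec k h) j = k j := by
  have := card_ofVec k h j
  rw [card_eq] at this
  exact Nat.add_right_cancel this

theorem fn_blk (φ : a ⟶ b) (j : b.Carrier) (s : Fin (card φ j)) :
    fn φ (blk (card φ) (sum_card φ) j s) = j := by
  have : fn φ = blkIdx (card φ) (sum_card φ) :=
    mono_ext (fn_mono φ) (blkIdx_mono _ _) (fun j => (blkIdx_card (card φ) (sum_card φ) j).symm)
  rw [this, blkIdx_blk]

theorem sum_blk (φ : a ⟶ b) (f : a.Carrier → ℕ) (j : b.Carrier) :
    ∑ s, f (blk (card φ) (sum_card φ) j s) =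
      ∑ i ∈ Finset.univ.filter (fun i => fn φ i = j), f i := by
  refine Finset.sum_bij (fun s _ => blk (card φ) (sum_card φ) j s) ?_ ?_ ?_ ?_
  · intro s _; simp [fn_blk]
  · intro s _ t _ hst
    have := (blkEquiv (card φ) (sum_card φ)).injective hst
    simpa using this
  · intro i hi
    obtain ⟨j', s, rfl⟩ := blk_surj (card φ) (sum_card φ) i
    simp only [Finset.mem_filter, Finset.mem_univ, true_and, fn_blk] at hi
    subst hi
    exact ⟨s, by simp, rfl⟩
  · intro s _; rfl

theorem card_comp (ψ : a ⟶ b) (φ : b ⟶ c) (j : c.Carrier) :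
    card (ψ ≫ φ) j = ∑ i ∈ Finset.univ.filter (fun i => fn φ i = j), card ψ i := by
  unfold card
  rw [Finset.card_eq_sum_card_fiberwise (f := fn ψ)
    (t := Finset.univ.filter (fun i => fn φ i = j)) (fun i hi => by
      have := (Finset.mem_filter.1 (Finset.mem_coe.1 hi)).2
      simpa [fn_comp] using this)]
  refine Finset.sum_congr rfl (fun i hi => ?_)
  congr 1
  ext p
  simp only [Finset.mem_filter, Finset.mem_univ, true_and, fn_comp] at hi ⊢
  refine ⟨fun h => h.2, fun h => ⟨?_, h⟩⟩
  refine Finset.mem_filter.2 ⟨Finset.mem_univ _, ?_⟩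
  rw [h]
  exact hi

end Nabla

/-! ## The functor from group operads to crossed interval groups -/

/-- The permutation of `⟪n⟫` extending `σ` and fixing `±∞`. -/
def ext {n : ℕ} (σ : Equiv.Perm (Fin n)) : Equiv.Perm (Fin (n + 2)) where
  toFun := Fin.cons 0 (Fin.snoc (α := fun _ => Fin (n + 2)) (fun i => mid (σ i)) (Fin.last _))
  invFun := Fin.cons 0 (Fin.snoc (α := fun _ => Fin (n + 2)) (fun i => mid (σ.symm i)) (Fin.last _))
  left_inv j := by
    rcases mid_cases j with rfl | rfl | ⟨i, rfl⟩
    · simp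
    · simp [← Fin.succ_last]
    · simp [mid]
  right_inv j := by
    rcases mid_cases j with rfl | rfl | ⟨i, rfl⟩
    · simp
    · simp [← Fin.succ_last]
    · simp [mid]

@[simp] theorem ext_zero {n : ℕ} (σ : Equiv.Perm (Fin n)) : ext σ 0 = 0 := rfl

@[simp] theorem ext_last {n : ℕ} (σ : Equiv.Perm (Fin n)) :
    ext σ (Fin.last (n + 1)) = Fin.last (n + 1) := by
  simp [ext, ← Fin.succ_last]

@[simp] theorem ext_mid {n : ℕ} (σ : Equiv.Perm (Fin n)) (i : Fin n) :
    ext σ (mid i) = mid (σ i) := by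
  simp [ext, mid]

theorem ext_one {n : ℕ} : ext (1 : Equiv.Perm (Fin n)) = 1 := by
  apply Equiv.ext
  intro j
  rcases mid_cases j with rfl | rfl | ⟨i, rfl⟩ <;> simp

theorem ext_mul {n : ℕ} (σ τ : Equiv.Perm (Fin n)) : ext (σ * τ) = ext σ * ext τ := by
  apply Equiv.ext
  intro j
  rcases mid_cases j with rfl | rfl | ⟨i, rfl⟩ <;> simp

theorem ext_inv {n : ℕ} (σ : Equiv.Perm (Fin n)) : (ext σ)⁻¹ = ext σ⁻¹ :=
  inv_eq_of_mul_eq_one_left (by rw [← ext_mul, inv_mul_cancel, ext_one])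

namespace Nabla

variable {a b c : Nabla}

theorem bd_ext {n : ℕ} (σ : Equiv.Perm (Fin n)) (j : Fin (n + 2)) : bd (ext σ j) = bd j := by
  rcases mid_cases j with rfl | rfl | ⟨i, rfl⟩ <;> simp

/-- The action of `𝔖ₙ` on `∇(⟪m⟫, ⟪n⟫)`: the morphism `φ^σ` with `k^{(φ^σ)}_{±∞} = k^{(φ)}_{±∞}`
and `k^{(φ^σ)}_j = k^{(φ)}_{σ⁻¹(j)}` for `1 ≤ j ≤ n`. -/
def permAct (σ : Equiv.Perm (Fin b.len)) (φ : a ⟶ b) : a ⟶ b :=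
  ofVec (fun j => vec φ ((ext σ)⁻¹ j)) (sum_perm (sum_vec φ) (ext σ))

theorem vec_permAct (σ : Equiv.Perm (Fin b.len)) (φ : a ⟶ b) (j : b.Carrier) :
    vec (permAct σ φ) j = vec φ ((ext σ)⁻¹ j) :=
  vec_ofVec _ (sum_perm (sum_vec φ) (ext σ)) j

theorem card_permAct (σ : Equiv.Perm (Fin b.len)) (φ : a ⟶ b) (j : b.Carrier) :
    card (permAct σ φ) j = card φ ((ext σ)⁻¹ j) := by
  rw [card_eq, card_eq, vec_permAct, ext_inv, bd_ext]

theorem fn_blk' (φ : a ⟶ b) {k : b.Carrier → ℕ} (hk : card φ = k) (h : ∑ j, k j = a.len + 2)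
    (j : b.Carrier) (s : Fin (k j)) : fn φ (blk k h j s) = j := by
  subst hk
  exact fn_blk φ j s

/-- The square relating `φ`, `φ^σ`, `σ` and the induced block permutation. -/
theorem fn_permAct (σ : Equiv.Perm (Fin b.len)) (φ : a ⟶ b) (p : a.Carrier) :
    fn (permAct σ φ) (permComp (card φ) (sum_card φ) (ext σ) (fun _ => 1) p) =
      ext σ (fn φ p) := by
  obtain ⟨j, s, rfl⟩ := blk_surj (card φ) (sum_card φ) p
  rw [permComp_blk, fn_blk]
  exact fn_blk' (permAct σ φ) (funext (card_permAct σ φ)) _ _ _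

theorem permAct_comp (ψ : a ⟶ b) (φ : b ⟶ c) (σ : Equiv.Perm (Fin c.len))
    (τ : Equiv.Perm (Fin b.len))
    (hτ : ext τ = permComp (card φ) (sum_card φ) (ext σ) (fun _ => 1)) :
    permAct σ (ψ ≫ φ) = permAct τ ψ ≫ permAct σ φ := by
  apply hom_ext_card
  intro j
  rw [card_permAct, card_comp, card_comp]
  simp only [card_permAct]
  refine Finset.sum_bij (fun i _ => ext τ i) ?_ ?_ ?_ ?_
  · intro i hi
    have hi := (Finset.mem_filter.1 hi).2
    refine Finset.mem_filter.2 ⟨Finset.mem_univ _, ?_⟩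
    rw [hτ, fn_permAct, hi]
    simp
  · intro i _ i' _ h
    exact (ext τ).injective h
  · intro i hi
    have hi := (Finset.mem_filter.1 hi).2
    refine ⟨(ext τ)⁻¹ i, Finset.mem_filter.2 ⟨Finset.mem_univ _, ?_⟩, by simp⟩
    apply (ext σ).injective
    rw [← fn_permAct, ← hτ]
    simpa using hi
  · intro i _
    simp

theorem vec_comp (ψ : a ⟶ b) (φ : b ⟶ c) (j : c.Carrier) :
    vec (ψ ≫ φ) j = ∑ s, vec ψ (blk (card φ) (sum_card φ) j s) := by
  rw [sum_blk]
  have h := card_comp ψ φ j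
  rw [Finset.sum_congr rfl (fun i _ => card_eq ψ i), Finset.sum_add_distrib, card_eq] at h
  have h2 : ∑ i ∈ Finset.univ.filter (fun i => fn φ i = j), bd i = bd j := by
    rw [Finset.sum_filter, sum_ends]
    rcases mid_cases j with rfl | rfl | ⟨i, rfl⟩
    · simp [fn_zero, fn_last]
    · simp [fn_zero, fn_last, Fin.ext_iff]
    · have := i.2
      simp [fn_zero, fn_last, Fin.ext_iff, mid_val]
      omega
  omega

theorem card_id (j : a.Carrier) : card (𝟙 a) j = 1 := by
  have : Finset.univ.filter (fun i => fn (𝟙 a) i = j) = {j} := by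
    ext i
    rw [Finset.mem_filter, fn_id]
    simp
  rw [card, this, Finset.card_singleton]

end Nabla

namespace GroupOperad

variable (X : GroupOperad.{u})

theorem perm_comp {n m : ℕ} (k : Fin n → ℕ) (h : ∑ i, k i = m) (x : X.obj n)
    (y : ∀ i, X.obj (k i)) :
    X.perm (X.comp k h x y) = permComp k h (X.perm x) (fun i => X.perm (y i)) :=
  X.toSymm.app_comp k h x y

theorem comp_mul {n m : ℕ} (k : Fin n → ℕ) (h : ∑ i, k i = m) (x y : X.obj n)
    (xs ys : ∀ i, X.obj (k i)) :
    X.comp k h (x * y) (xs * ys) =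
      X.comp (fun i => k ((X.perm y)⁻¹ i)) (sum_perm h (X.perm y)) x
        (fun i => xs ((X.perm y)⁻¹ i)) * X.comp k h y ys :=
  X.interchange k h x y xs ys

theorem comp_one_mul {n m : ℕ} (k : Fin n → ℕ) (h : ∑ i, k i = m) (xs ys : ∀ i, X.obj (k i)) :
    X.comp k h 1 (xs * ys) = X.comp k h 1 xs * X.comp k h 1 ys := by
  have aux : ∀ (τ : Equiv.Perm (Fin n)) (hτ : τ = 1) (h2 : ∑ i, k (τ⁻¹ i) = m),
      X.comp (fun i => k (τ⁻¹ i)) h2 1 (fun i => xs (τ⁻¹ i)) = X.comp k h 1 xs := by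
    rintro τ rfl h2
    rfl
  have := X.comp_mul k h 1 1 xs ys
  rw [mul_one, aux _ (map_one X.perm)] at this
  exact this

theorem comp_units {n m : ℕ} (k : Fin n → ℕ) (h : ∑ i, k i = m) : X.comp k h 1 1 = 1 := by
  have := X.comp_one_mul k h 1 1
  rw [mul_one] at this
  exact left_eq_mul.1 this

theorem one_eq : X.one = 1 := by
  have hk : ∑ _i : Fin 1, 1 = 1 := by simp
  have h : X.comp (fun _ : Fin 1 => 1) hk (X.one * 1) ((fun _ => 1) * (fun _ => X.one)) =
      X.comp (fun _ : Fin 1 => 1) hk X.one (fun _ => 1) *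
      X.comp (fun _ : Fin 1 => 1) hk 1 (fun _ => X.one) :=
    X.comp_mul (fun _ : Fin 1 => 1) hk X.one 1 (fun _ => 1) (fun _ => X.one)
  have h1 : X.comp (fun _ : Fin 1 => 1) hk X.one (fun _ => X.one) = X.one := X.one_comp _
  have h2 : X.comp (fun _ : Fin 1 => 1) hk (1 : X.obj 1) (fun _ => X.one) = 1 := X.comp_one _
  have h3 : X.comp (fun _ : Fin 1 => 1) hk X.one (fun _ => (1 : X.obj 1)) = 1 := X.one_comp _
  have h4 : ((fun _ => 1) * (fun _ => X.one) : Fin 1 → X.obj 1) = fun _ => X.one := by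
    funext i
    simp
  rw [h2, h3, h4, mul_one, mul_one, h1] at h
  exact h

/-- The triple `(e_a, x, e_c)`. -/
def tri {n : ℕ} (a c : ℕ) (x : X.obj n) : ∀ i : Fin 3, X.obj (![a, n, c] i)
  | 0 => (1 : X.obj a)
  | 1 => x
  | 2 => (1 : X.obj c)

theorem tri_eq {n : ℕ} (a c : ℕ) (x : X.obj n) :
    X.tri a c x = Pi.mulSingle (M := fun i => X.obj (![a, n, c] i)) 1 x := by
  funext i
  fin_cases i
  · exact (Pi.mulSingle_eq_of_ne (M := fun i => X.obj (![a, n, c] i)) (show (0 : Fin 3) ≠ 1 by decide) _).symm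
  · exact (Pi.mulSingle_eq_same (M := fun i => X.obj (![a, n, c] i)) _ _).symm
  · exact (Pi.mulSingle_eq_of_ne (M := fun i => X.obj (![a, n, c] i)) (show (2 : Fin 3) ≠ 1 by decide) _).symm

/-- The element `γ(e₃; e_a, x, e_c)`. -/
def ins {n m : ℕ} (a c : ℕ) (h : a + n + c = m) (x : X.obj n) : X.obj m :=
  X.comp ![a, n, c] (by simpa [Fin.sum_univ_three] using h) 1 (X.tri a c x)

theorem ins_eq {n m : ℕ} (a c : ℕ) (h : a + n + c = m) (h' : ∑ i, ![a, n, c] i = m)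
    (x : X.obj n) : X.ins a c h x = X.comp ![a, n, c] h' 1
      (Pi.mulSingle (M := fun i => X.obj (![a, n, c] i)) 1 x) := by
  rw [← tri_eq]
  rfl

theorem single_hcongr {n m m' : ℕ} {k k' : Fin n → ℕ} {h : ∑ i, k i = m} {h' : ∑ i, k' i = m'}
    {i i' : Fin n} {x : X.obj (k i)} {x' : X.obj (k' i')} (hk : k = k') (hi : i = i')
    (hx : HEq x x') :
    HEq (X.comp k h 1 (Pi.mulSingle (M := fun i => X.obj (k i)) i x))
      (X.comp k' h' 1 (Pi.mulSingle (M := fun i => X.obj (k' i)) i' x')) := by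
  subst hk hi h h'
  rw [eq_of_heq hx]

theorem single_congr {n m : ℕ} {k k' : Fin n → ℕ} {h : ∑ i, k i = m} {h' : ∑ i, k' i = m}
    {i i' : Fin n} {x : X.obj (k i)} {x' : X.obj (k' i')} (hk : k = k') (hi : i = i')
    (hx : HEq x x') :
    X.comp k h 1 (Pi.mulSingle (M := fun i => X.obj (k i)) i x) =
      X.comp k' h' 1 (Pi.mulSingle (M := fun i => X.obj (k' i)) i' x') :=
  eq_of_heq (X.single_hcongr hk hi hx)

theorem single_fin_one {m : ℕ} {k : Fin 1 → ℕ} {h : ∑ i, k i = m} {i : Fin 1} (x : X.obj (k i)) :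
    HEq (X.comp k h 1 (Pi.mulSingle (M := fun i => X.obj (k i)) i x)) x := by
  obtain rfl : i = 0 := Subsingleton.elim _ _
  have hm : k 0 = m := by simpa using h
  subst hm
  have hk : k = fun _ => k 0 := by funext j; rw [Subsingleton.elim j 0]
  refine heq_of_eq ?_
  have h1 := X.one_comp x
  rw [one_eq] at h1
  refine Eq.trans ?_ h1
  rw [X.single_congr (k' := fun _ => k 0) (h' := by simp) (i' := 0) (x' := x) hk rfl HEq.rfl]
  congr 1
  funext j
  obtain rfl : j = 0 := Subsingleton.elim _ _
  simp

theorem regroup3 {m r : ℕ} (k : Fin 3 → ℕ) (h : ∑ i, k i = m) (l : Fin m → ℕ)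
    (h' : ∑ p, l p = r) (s : Fin (k 1)) (x : X.obj (l (blk k h 1 s))) {A N C : ℕ}
    (hA : ∑ s, l (blk k h 0 s) = A) (hN : ∑ s, l (blk k h 1 s) = N)
    (hC : ∑ s, l (blk k h 2 s) = C) (hr : A + N + C = r) :
    X.comp l h' 1 (Pi.mulSingle (M := fun p => X.obj (l p)) (blk k h 1 s) x) =
      X.ins A C hr (X.comp (fun s => l (blk k h 1 s)) hN 1
        (Pi.mulSingle (M := fun s => X.obj (l (blk k h 1 s))) s x)) := by
  subst hA hN hC
  have h'' : ∑ i, ∑ s, l (blk k h i s) = r := by rw [Fin.sum_univ_three]; exact hr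
  have key := X.assoc k h l h' h'' 1 1 (Pi.mulSingle (M := fun p => X.obj (l p)) (blk k h 1 s) x)
  rw [comp_units] at key
  rw [key]
  have inj : ∀ i (t : Fin (k i)), blk k h i t = blk k h 1 s → (⟨i, t⟩ : Σ i, Fin (k i)) = ⟨1, s⟩ :=
    fun i t hit => (blkEquiv k h).injective hit
  have e : (fun i => X.comp (fun t => l (blk k h i t)) rfl ((1 : ∀ i, X.obj (k i)) i)
      (fun t => Pi.mulSingle (M := fun p => X.obj (l p)) (blk k h 1 s) x (blk k h i t))) =
      Pi.mulSingle (M := fun i => X.obj (∑ t, l (blk k h i t))) 1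
        (X.comp (fun s => l (blk k h 1 s)) rfl 1
        (Pi.mulSingle (M := fun s => X.obj (l (blk k h 1 s))) s x)) := by
    funext i
    by_cases hi : i = 1
    · subst hi
      rw [Pi.mulSingle_eq_same]
      congr 1
      funext t
      by_cases ht : t = s
      · subst ht; simp
      · rw [Pi.mulSingle_eq_of_ne ht, Pi.mulSingle_eq_of_ne]
        intro hit
        exact ht (by simpa using inj _ _ hit)
    · rw [Pi.mulSingle_eq_of_ne hi]
      refine Eq.trans ?_ (X.comp_units (fun t => l (blk k h i t)) rfl)
      congr 1
      funext t
      rw [Pi.mulSingle_eq_of_ne]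
      · rfl
      · intro hit
        exact hi (congrArg Sigma.fst (inj _ _ hit))
  rw [e, X.ins_eq _ _ _ (by simpa [Fin.sum_univ_three] using hr)]
  refine X.single_congr ?_ rfl HEq.rfl
  funext i
  fin_cases i <;> rfl

theorem ins_congr {a a' c c' n n' m : ℕ} {h : a + n + c = m} {h' : a' + n' + c' = m}
    {x : X.obj n} {x' : X.obj n'} (ha : a = a') (hc : c = c') (hx : HEq x x') :
    X.ins a c h x = X.ins a' c' h' x' := by
  subst ha hc
  obtain rfl : n = n' := by omega
  rw [eq_of_heq hx]

theorem regroup3' {m r : ℕ} (k : Fin 3 → ℕ) (h : ∑ i, k i = m) (l : Fin m → ℕ)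
    (h' : ∑ p, l p = r) (s : Fin (k 1)) (q : Fin m) (hq : blk k h 1 s = q) (x : X.obj (l q))
    {A N C : ℕ} (hA : ∑ s, l (blk k h 0 s) = A) (hN : ∑ s, l (blk k h 1 s) = N)
    (hC : ∑ s, l (blk k h 2 s) = C) (hr : A + N + C = r) (y : X.obj N)
    (hy : ∀ x' : X.obj (l (blk k h 1 s)), HEq x' x →
      HEq (X.comp (fun s => l (blk k h 1 s)) hN 1
        (Pi.mulSingle (M := fun s => X.obj (l (blk k h 1 s))) s x')) y) :
    X.comp l h' 1 (Pi.mulSingle (M := fun p => X.obj (l p)) q x) = X.ins A C hr y := by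
  subst hq
  rw [X.regroup3 k h l h' s x hA hN hC hr]
  exact X.ins_congr rfl rfl (hy x HEq.rfl)

theorem ins_zero {n : ℕ} (x : X.obj n) : X.ins 0 0 (by simp) x = x := by
  have h := X.regroup3' (m := 1) (r := n) ![0, 1, 0] (by simp [Fin.sum_univ_three]) (fun _ => n)
    (by simp) (0 : Fin 1) 0 (Subsingleton.elim _ _) x (A := 0) (N := n) (C := 0)
    (Finset.sum_empty) (Fin.sum_univ_one _) (Finset.sum_empty) (by simp) x
    (fun x' hx' => (X.single_fin_one (k := fun _ => n) (h := by simp) (i := 0) x').trans hx')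
  rw [← h]
  exact eq_of_heq (X.single_fin_one (k := fun _ => n) (h := by simp) (i := 0) x)

theorem ins_ins {n m r a c b d : ℕ} (h : a + n + c = m) (h' : b + m + d = r) (x : X.obj n) :
    X.ins b d h' (X.ins a c h x) = X.ins (b + a) (c + d) (by omega) x := by
  have hL : ∑ i, ![b, a, n, c, d] i = r := by
    simp [Fin.sum_univ_five]; omega
  have h1 : ∑ i, (![1, 3, 1] : Fin 3 → ℕ) i = 5 := rfl
  have h2 : ∑ i, (![2, 1, 2] : Fin 3 → ℕ) i = 5 := rfl
  have v1 : ∀ (i : Fin 3) (s : Fin ((![1, 3, 1] : Fin 3 → ℕ) i)) (p : Fin 5),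
      ∑ j ∈ Finset.univ.filter (· < i), (![1, 3, 1] : Fin 3 → ℕ) j + (s : ℕ) = p →
      blk ![1, 3, 1] h1 i s = p :=
    fun i s p hp => Fin.ext ((blk_val _ h1 i s).trans hp)
  have v2 : ∀ (i : Fin 3) (s : Fin ((![2, 1, 2] : Fin 3 → ℕ) i)) (p : Fin 5),
      ∑ j ∈ Finset.univ.filter (· < i), (![2, 1, 2] : Fin 3 → ℕ) j + (s : ℕ) = p →
      blk ![2, 1, 2] h2 i s = p :=
    fun i s p hp => Fin.ext ((blk_val _ h2 i s).trans hp)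
  have a0 : blk ![1, 3, 1] h1 0 (0 : Fin 1) = 0 := v1 0 (0 : Fin 1) 0 rfl
  have a1 : blk ![1, 3, 1] h1 1 (0 : Fin 3) = 1 := v1 1 (0 : Fin 3) 1 rfl
  have a2 : blk ![1, 3, 1] h1 1 (1 : Fin 3) = 2 := v1 1 (1 : Fin 3) 2 rfl
  have a3 : blk ![1, 3, 1] h1 1 (2 : Fin 3) = 3 := v1 1 (2 : Fin 3) 3 rfl
  have a4 : blk ![1, 3, 1] h1 2 (0 : Fin 1) = 4 := v1 2 (0 : Fin 1) 4 rfl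
  have b0 : blk ![2, 1, 2] h2 0 (0 : Fin 2) = 0 := v2 0 (0 : Fin 2) 0 rfl
  have b1 : blk ![2, 1, 2] h2 0 (1 : Fin 2) = 1 := v2 0 (1 : Fin 2) 1 rfl
  have b2 : blk ![2, 1, 2] h2 1 (0 : Fin 1) = 2 := v2 1 (0 : Fin 1) 2 rfl
  have b3 : blk ![2, 1, 2] h2 2 (0 : Fin 2) = 3 := v2 2 (0 : Fin 2) 3 rfl
  have b4 : blk ![2, 1, 2] h2 2 (1 : Fin 2) = 4 := v2 2 (1 : Fin 2) 4 rfl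
  have e1 := X.regroup3' ![1, 3, 1] h1 ![b, a, n, c, d] hL (1 : Fin 3) 2 a2 x
    (A := b) (N := m) (C := d)
    ((Fin.sum_univ_one (fun s : Fin 1 => ![b, a, n, c, d] (blk ![1, 3, 1] h1 0 s))).trans
      (by rw [a0]; rfl))
    ((Fin.sum_univ_three (fun s : Fin 3 => ![b, a, n, c, d] (blk ![1, 3, 1] h1 1 s))).trans
      (by rw [a1, a2, a3]; exact h))
    ((Fin.sum_univ_one (fun s : Fin 1 => ![b, a, n, c, d] (blk ![1, 3, 1] h1 2 s))).trans
      (by rw [a4]; rfl)) h' (X.ins a c h x)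
    (fun x' hx' => by
      rw [X.ins_eq a c h (by simpa [Fin.sum_univ_three] using h)]
      refine X.single_hcongr (n := 3) (i := 1) (i' := 1) (k' := ![a, n, c]) ?_ rfl hx'
      funext s
      fin_cases s
      · exact congrArg ![b, a, n, c, d] a1
      · exact congrArg ![b, a, n, c, d] a2
      · exact congrArg ![b, a, n, c, d] a3)
  have e2 := X.regroup3' ![2, 1, 2] h2 ![b, a, n, c, d] hL (0 : Fin 1) 2 b2 x
    (A := b + a) (N := n) (C := c + d)
    ((Fin.sum_univ_two (fun s : Fin 2 => ![b, a, n, c, d] (blk ![2, 1, 2] h2 0 s))).trans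
      (by rw [b0, b1]; rfl))
    ((Fin.sum_univ_one (fun s : Fin 1 => ![b, a, n, c, d] (blk ![2, 1, 2] h2 1 s))).trans
      (by rw [b2]; rfl))
    ((Fin.sum_univ_two (fun s : Fin 2 => ![b, a, n, c, d] (blk ![2, 1, 2] h2 2 s))).trans
      (by rw [b3, b4]; rfl)) (by omega) x
    (fun x' hx' => (X.single_fin_one (k := fun s => ![b, a, n, c, d] (blk ![2, 1, 2] h2 1 s)) x').trans
      hx')
  rw [← e1, e2]

/-- `γ(e₃; e₁, x, e₁)`. -/
def tilde {n : ℕ} (x : X.obj n) : X.obj (n + 2) := X.ins 1 1 (by omega) x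

theorem blk_tilde {n : ℕ} (h : ∑ i, ![1, n, 1] i = n + 2) :
    (∀ s : Fin 1, blk ![1, n, 1] h 0 s = 0) ∧ (∀ s : Fin n, blk ![1, n, 1] h 1 s = mid s) ∧
      (∀ s : Fin 1, blk ![1, n, 1] h 2 s = Fin.last (n + 1)) := by
  have e0 : Finset.univ.filter (· < (0 : Fin 3)) = ∅ := rfl
  have e1 : Finset.univ.filter (· < (1 : Fin 3)) = {0} := rfl
  have e2 : Finset.univ.filter (· < (2 : Fin 3)) = {0, 1} := rfl
  refine ⟨fun s => Fin.ext ((blk_val _ h 0 s).trans ?_),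
    fun s => Fin.ext ((blk_val _ h 1 s).trans ?_),
    fun s => Fin.ext ((blk_val _ h 2 s).trans ?_)⟩
  · rw [e0]; simp
  · rw [e1, Finset.sum_singleton, mid_val, add_comm]; rfl
  · rw [e2, Finset.sum_pair (by decide), Subsingleton.elim s (0 : Fin 1)]
    change 1 + n + 0 = n + 1
    omega

theorem tilde_comp {n r N : ℕ} (x : X.obj n) (l : Fin (n + 2) → ℕ) (hl : ∑ j, l j = r)
    (hN : ∑ i, l (mid i) = N) (hr : l 0 + N + l (Fin.last (n + 1)) = r) :
    X.comp l hl (X.tilde x) 1 =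
      X.ins (l 0) (l (Fin.last (n + 1))) hr (X.comp (fun i => l (mid i)) hN x 1) := by
  have h : ∑ i, ![1, n, 1] i = n + 2 := by simp [Fin.sum_univ_three]; omega
  obtain ⟨b0, b1, b2⟩ := blk_tilde h
  subst hN
  have s0 : ∑ s, l (blk ![1, n, 1] h 0 s) = l 0 :=
    (Fin.sum_univ_one (fun s : Fin 1 => l (blk ![1, n, 1] h 0 s))).trans (by rw [b0])
  have s1 : (fun s => l (blk ![1, n, 1] h 1 s)) = fun s => l (mid s) :=
    funext (fun s => congrArg l (b1 s))
  have s2 : ∑ s, l (blk ![1, n, 1] h 2 s) = l (Fin.last (n + 1)) :=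
    (Fin.sum_univ_one (fun s : Fin 1 => l (blk ![1, n, 1] h 2 s))).trans (by rw [b2])
  have h'' : ∑ i, ∑ s, l (blk ![1, n, 1] h i s) = r := by
    rw [Fin.sum_univ_three, s0, s2, s1]; exact hr
  have key := X.assoc ![1, n, 1] h l hl h'' 1
    (X.tri 1 1 x) 1
  refine Eq.trans key ?_
  have e : (fun i => X.comp (fun t => l (blk ![1, n, 1] h i t)) rfl
      (X.tri 1 1 x i)
      (fun t => (1 : ∀ p, X.obj (l p)) (blk ![1, n, 1] h i t))) =
      Pi.mulSingle (M := fun i => X.obj (∑ t, l (blk ![1, n, 1] h i t))) 1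
        (X.comp (fun t => l (blk ![1, n, 1] h 1 t)) rfl x 1) := by
    funext i
    by_cases hi : i = 1
    · subst hi
      rw [Pi.mulSingle_eq_same]
      rfl
    · have h1 : X.tri 1 1 x i = 1 := by
        rw [tri_eq]
        exact Pi.mulSingle_eq_of_ne (M := fun i => X.obj (![1, n, 1] i)) hi x
      rw [Pi.mulSingle_eq_of_ne hi, h1]
      exact X.comp_units (fun t => l (blk ![1, n, 1] h i t)) rfl
  rw [e, X.ins_eq _ _ _ (by simpa [Fin.sum_univ_three] using hr)]
  refine X.single_congr ?_ rfl ?_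
  · funext i
    fin_cases i
    · exact s0
    · exact congrArg (fun f : Fin n → ℕ => ∑ s, f s) s1
    · exact s2
  · have aux : ∀ (k k' : Fin n → ℕ), k = k' →
        HEq (X.comp k rfl x 1) (X.comp k' rfl x 1) := by
      rintro k _ rfl; rfl
    exact aux _ _ s1

theorem comp_one_congr {n m : ℕ} {k k' : Fin n → ℕ} {h : ∑ i, k i = m} {h' : ∑ i, k' i = m}
    (hk : k = k') (x : X.obj n) : X.comp k h x 1 = X.comp k' h' x 1 := by
  subst hk; rfl

theorem comp_one_hcongr {n m m' : ℕ} {k k' : Fin n → ℕ} {h : ∑ i, k i = m}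
    {h' : ∑ i, k' i = m'} (hk : k = k') (x : X.obj n) :
    HEq (X.comp k h x 1) (X.comp k' h' x 1) := by
  subst hk h h'; rfl

theorem perm_tilde {n : ℕ} (x : X.obj n) : X.perm (X.tilde x) = ext (X.perm x) := by
  have h : ∑ i, ![1, n, 1] i = n + 2 := by simp [Fin.sum_univ_three]; omega
  obtain ⟨b0, b1, b2⟩ := blk_tilde h
  have e0 : Finset.univ.filter (fun j => j < (0 : Fin 3)) = ∅ := rfl
  have e1 : Finset.univ.filter (· < (1 : Fin 3)) = {0} := rfl
  have e2 : Finset.univ.filter (· < (2 : Fin 3)) = {0, 1} := rfl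
  have key : X.perm (X.tilde x) = permComp ![1, n, 1] h 1
      (fun i => X.perm (X.tri 1 1 x i)) := by
    rw [← map_one X.perm]
    exact X.perm_comp _ _ _ _
  rw [key]
  have val : ∀ i (s : Fin (![1, n, 1] i)), permComp ![1, n, 1] h 1
      (fun i => X.perm (X.tri 1 1 x i))
      (blk ![1, n, 1] h i s) = blk ![1, n, 1] h i
        (X.perm (X.tri 1 1 x i) s) := by
    intro i s
    apply Fin.ext
    rw [permComp_val, blk_val]
    rfl
  apply Equiv.ext
  intro j
  rcases mid_cases j with rfl | rfl | ⟨i, rfl⟩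
  · rw [ext_zero]
    conv_lhs => rw [← b0 0]
    exact (val _ _).trans (b0 _)
  · rw [ext_last]
    conv_lhs => rw [← b2 0]
    exact (val _ _).trans (b2 _)
  · rw [ext_mid]
    conv_lhs => rw [← b1 i]
    exact (val _ _).trans (b1 _)

theorem sum_vec_mid {a b : Nabla} (φ : a ⟶ b) :
    Nabla.vec φ 0 + ∑ i, Nabla.vec φ (mid i) + Nabla.vec φ (Fin.last _) = a.len :=
  (Nabla.sum_ends _).symm.trans (Nabla.sum_vec φ)

/-- The map `φ*(x) = γ(e₃; e_{-∞}^φ, γ(x; e₁^φ, …, eₙ^φ), e_∞^φ)`, where `e_j^φ` is the unit of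
`𝒢(k_j^{(φ)})`. -/
def pull {a b : Nabla} (φ : a ⟶ b) (x : X.obj b.len) : X.obj a.len :=
  X.ins (Nabla.vec φ 0) (Nabla.vec φ (Fin.last _)) (sum_vec_mid φ)
    (X.comp (fun i => Nabla.vec φ (mid i)) rfl x (fun _ => 1))

theorem pull_eq {a b : Nabla} (φ : a ⟶ b) (x : X.obj b.len) :
    X.pull φ x = X.comp (Nabla.vec φ) (Nabla.sum_vec φ) (X.tilde x) 1 :=
  (X.tilde_comp x (Nabla.vec φ) (Nabla.sum_vec φ) rfl (sum_vec_mid φ)).symm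

theorem tilde_pull {a b : Nabla} (φ : a ⟶ b) (x : X.obj b.len) :
    X.tilde (X.pull φ x) = X.comp (Nabla.card φ) (Nabla.sum_card φ) (X.tilde x) 1 := by
  have hm : (fun i => Nabla.card φ (mid i)) = fun i => Nabla.vec φ (mid i) := by
    funext i
    rw [Nabla.card_eq, Nabla.bd_mid, add_zero]
  have h0 : Nabla.card φ 0 = Nabla.vec φ 0 + 1 := by rw [Nabla.card_eq, Nabla.bd_zero]
  have hl : Nabla.card φ (Fin.last _) = Nabla.vec φ (Fin.last _) + 1 := by
    rw [Nabla.card_eq, Nabla.bd_last]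
  have hs := sum_vec_mid φ
  rw [X.tilde_comp x (Nabla.card φ) (Nabla.sum_card φ) rfl
    (by rw [hm, h0, hl]; omega)]
  unfold tilde pull
  rw [ins_ins]
  refine X.ins_congr (by rw [h0, add_comm]) hl.symm ?_
  exact X.comp_one_hcongr hm.symm x

theorem pull_id {a : Nabla} (x : X.obj a.len) : X.pull (𝟙 a) x = x := by
  have hv : ∀ j, Nabla.vec (𝟙 a) j = 1 - Nabla.bd j := fun j => by
    rw [Nabla.vec, Nabla.card_id]
  have hm : (fun i => Nabla.vec (𝟙 a) (mid i)) = fun _ => 1 := by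
    funext i
    rw [hv, Nabla.bd_mid]
  refine Eq.trans ?_ (X.ins_zero x)
  refine X.ins_congr (by rw [hv, Nabla.bd_zero]) (by rw [hv, Nabla.bd_last]) ?_
  have h1 := X.comp_one x
  rw [one_eq] at h1
  refine HEq.trans ?_ (heq_of_eq h1)
  exact X.comp_one_hcongr hm x

theorem pull_comp {a b c : Nabla} (ψ : c ⟶ b) (φ : b ⟶ a) (x : X.obj a.len) :
    X.pull (ψ ≫ φ) x = X.pull ψ (X.pull φ x) := by
  rw [pull_eq, pull_eq X ψ, tilde_pull]
  have h'' : ∑ j, ∑ s, Nabla.vec ψ (blk (Nabla.card φ) (Nabla.sum_card φ) j s) = c.len := by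
    rw [← Nabla.sum_vec (ψ ≫ φ)]
    exact Finset.sum_congr rfl (fun j _ => (Nabla.vec_comp ψ φ j).symm)
  have key := X.assoc (Nabla.card φ) (Nabla.sum_card φ) (Nabla.vec ψ) (Nabla.sum_vec ψ) h''
    (X.tilde x) 1 1
  refine Eq.trans ?_ key.symm
  have e : (fun i => X.comp
      (fun s => Nabla.vec ψ (blk (Nabla.card φ) (Nabla.sum_card φ) i s)) rfl
      ((1 : ∀ i, X.obj (Nabla.card φ i)) i)
      (fun s => (1 : ∀ p, X.obj (Nabla.vec ψ p)) (blk (Nabla.card φ) (Nabla.sum_card φ) i s))) =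
      1 := funext (fun i => X.comp_units _ rfl)
  rw [e]
  exact X.comp_one_congr (funext (Nabla.vec_comp ψ φ)) _

theorem ins_mul {n m a c : ℕ} (h : a + n + c = m) (x y : X.obj n) :
    X.ins a c h (x * y) = X.ins a c h x * X.ins a c h y := by
  unfold ins
  rw [← comp_one_mul]
  congr 1
  funext i
  fin_cases i
  · exact (mul_one (1 : X.obj a)).symm
  · rfl
  · exact (mul_one (1 : X.obj c)).symm

theorem pull_mul {a b : Nabla} (φ : a ⟶ b) (x y : X.obj b.len) :
    X.pull φ (x * y) = X.pull (Nabla.permAct (X.perm y) φ) x * X.pull φ y := by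
  have h1 := X.comp_mul (fun i => Nabla.vec φ (mid i)) rfl x y 1 1
  rw [mul_one] at h1
  have h2 : X.pull φ (x * y) = X.ins (Nabla.vec φ 0) (Nabla.vec φ (Fin.last _)) (sum_vec_mid φ)
    (X.comp (fun i => Nabla.vec φ (mid i)) rfl (x * y) 1) := rfl
  rw [h2, h1, ins_mul]
  congr 1
  refine X.ins_congr ?_ ?_ ?_
  · rw [Nabla.vec_permAct, ext_inv, ext_zero]
  · rw [Nabla.vec_permAct, ext_inv, ext_last]
  · refine X.comp_one_hcongr ?_ x
    funext i
    rw [Nabla.vec_permAct, ext_inv, ext_mid]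

/-- The crossed interval group `Ψ̂(𝒢)`: the groups are `𝒢(n)`, a morphism `φ` acts by
`φ*(x) = γ(e₃; e_{-∞}^φ, γ(x; e₁^φ, …, eₙ^φ), e_∞^φ)`, and `𝒢(n)` acts on morphisms through
`𝔖ₙ`. -/
def toCrossed : CrossedGroup.{u} Nabla where
  obj a := X.obj a.len
  map φ x := X.pull φ x
  map_id x := X.pull_id x
  map_comp ψ φ x := X.pull_comp ψ φ x
  act x φ := Nabla.permAct (X.perm x) φ
  one_act φ := by
    apply Nabla.hom_ext_vec
    intro j
    rw [Nabla.vec_permAct, map_one, ext_one]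
    rfl
  mul_act x y φ := by
    apply Nabla.hom_ext_vec
    intro j
    rw [Nabla.vec_permAct, Nabla.vec_permAct, Nabla.vec_permAct, map_mul, ext_mul, mul_inv_rev]
    rfl
  comp_act ψ φ x := by
    apply Nabla.permAct_comp
    rw [← perm_tilde, tilde_pull, perm_comp, perm_tilde]
    congr 1
    funext i
    exact map_one X.perm
  map_mul φ x y := X.pull_mul φ x y

theorem Hom.app_ins {X : GroupOperad.{u}} {Y : GroupOperad.{v}} (f : GroupOperad.Hom X Y)
    {n m a c : ℕ} (h : a + n + c = m) (x : X.obj n) :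
    f.toHom.app m (X.ins a c h x) = Y.ins a c h (f.toHom.app n x) := by
  have h1 : ∀ n, f.toHom.app n 1 = 1 := fun n => by
    have := f.app_mul (1 : X.obj n) 1
    rw [mul_one] at this
    exact left_eq_mul.1 this
  unfold ins
  rw [f.toHom.app_comp, h1]
  congr 1
  funext i
  fin_cases i
  · exact h1 a
  · rfl
  · exact h1 c

theorem Hom.app_pull {X : GroupOperad.{u}} {Y : GroupOperad.{v}} (f : GroupOperad.Hom X Y)
    {a b : Nabla} (φ : a ⟶ b) (x : X.obj b.len) :
    f.toHom.app a.len (X.pull φ x) = Y.pull φ (f.toHom.app b.len x) := by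
  have h1 : ∀ n, f.toHom.app n 1 = 1 := fun n => by
    have := f.app_mul (1 : X.obj n) 1
    rw [mul_one] at this
    exact left_eq_mul.1 this
  unfold pull
  rw [f.app_ins, f.toHom.app_comp]
  simp only [h1]

/-- `Ψ̂` on maps. -/
def Hom.toCrossed {X : GroupOperad.{u}} {Y : GroupOperad.{v}} (f : GroupOperad.Hom X Y) :
    CrossedGroup.Hom X.toCrossed Y.toCrossed where
  app a x := f.toHom.app a.len x
  app_map φ x := f.app_pull φ x
  app_mul x y := f.app_mul x y
  act_app x φ := congrArg (fun σ => Nabla.permAct σ φ) (f.app_toSymm x)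

end GroupOperad

/-- Crossed interval groups; `G_n` is `G.obj ⟨n⟩`. -/
abbrev CrossedIntervalGroup := CrossedGroup.{u} Nabla

/-- The functor `Ψ̂` from group operads to crossed interval groups. -/
def PsiHat : GroupOperad.{u} ⥤ CrossedIntervalGroup.{u} where
  obj X := X.toCrossed
  map f := GroupOperad.Hom.toCrossed f

/-- The crossed interval group `𝔖` of symmetric groups. -/
def symmCrossed : CrossedIntervalGroup.{0} := GroupOperad.symm.toCrossed

/-! ## Operadic and tame crossed interval groups -/

namespace Nabla

variable {a b c : Nabla}

/-- The element `j` of `⟪n⟫` as a morphism `⟪1⟫ → ⟪n⟫`, under the identification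
`∇(⟪1⟫, ⟪n⟫) = ⟪n⟫`, `φ ↦ φ(1)`. -/
def pt (j : b.Carrier) : (⟨1⟩ : Nabla) ⟶ b :=
  show BoundedOrderHom (Fin 3) b.Carrier from
  { toFun := ![0, j, Fin.last _]
    monotone' := by
      rw [Fin.monotone_iff_le_succ]
      intro i
      fin_cases i
      · exact Fin.zero_le _
      · exact Fin.le_last _
    map_bot' := rfl
    map_top' := rfl }

theorem pt_fn_one (φ : (⟨1⟩ : Nabla) ⟶ b) : pt (fn φ (1 : Fin 3)) = φ := by
  apply hom_ext
  intro (i : Fin 3)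
  fin_cases i
  · exact (fn_zero φ).symm
  · rfl
  · exact (fn_last φ).symm

theorem fn_pt (j : b.Carrier) : fn (pt j) (1 : Fin 3) = j := rfl

/-- A morphism of `∇` is inert if it restricts to a bijection
`φ⁻¹{1, …, n} → {1, …, n}`. -/
def IsInert (φ : a ⟶ b) : Prop :=
  Set.BijOn (fn φ) (fn φ ⁻¹' Set.range mid) (Set.range mid)

/-- A morphism of `∇` that factors through `⟪0⟫`. -/
def FactorsZero (φ : a ⟶ b) : Prop :=
  ∃ (f : a ⟶ (⟨0⟩ : Nabla)) (g : (⟨0⟩ : Nabla) ⟶ b), φ = f ≫ g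

/-- Two morphisms `φ₁`, `φ₂` with domain `⟪n⟫` are dissociated if, for every `α : ⟪1⟫ → ⟪n⟫`,
`φ₁α` or `φ₂α` factors through `⟪0⟫`. -/
def Dissociated (φ₁ : a ⟶ b) (φ₂ : a ⟶ c) : Prop :=
  ∀ α : (⟨1⟩ : Nabla) ⟶ a, FactorsZero (α ≫ φ₁) ∨ FactorsZero (α ≫ φ₂)

theorem factorsZero_pt (j : b.Carrier) :
    FactorsZero (pt j) ↔ j = 0 ∨ j = Fin.last (b.len + 1) := by
  constructor
  · rintro ⟨f, g, h⟩
    have h1 : j = fn g (fn f (1 : Fin 3)) := by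
      rw [← fn_comp, ← h, fn_pt]
    rcases mid_cases (n := 0) (fn f (1 : Fin 3)) with h2 | h2 | ⟨i, _⟩
    · left; rw [h1, h2]; exact fn_zero g
    · right; rw [h1, h2]; exact fn_last g
    · exact i.elim0
  · have g : (⟨0⟩ : Nabla) ⟶ b :=
      show BoundedOrderHom (Fin 2) b.Carrier from
      { toFun := ![0, Fin.last _]
        monotone' := by
          rw [Fin.monotone_iff_le_succ]
          intro i
          fin_cases i
          exact Fin.zero_le _
        map_bot' := rfl
        map_top' := rfl }
    rintro (rfl | rfl)
    · refine ⟨pt 0, g, ?_⟩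
      rw [← pt_fn_one (pt 0 ≫ g), fn_comp, fn_pt]
      exact congrArg pt (fn_zero g).symm
    · refine ⟨pt (Fin.last 1), g, ?_⟩
      rw [← pt_fn_one (pt (Fin.last 1) ≫ g), fn_comp, fn_pt]
      exact congrArg pt (fn_last g).symm

/-- The active morphism `μ_k : ⟪k₁ + ⋯ + kₙ⟫ → ⟪n⟫` with `#μ_k⁻¹{j} = k_j` for `1 ≤ j ≤ n`;
its vector is `(0, k₁, …, kₙ, 0)`. -/
def mu {n m : ℕ} (k : Fin n → ℕ) (h : ∑ i, k i = m) : (⟨m⟩ : Nabla) ⟶ ⟨n⟩ :=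
  ofVec (Fin.cons 0 (Fin.snoc (α := fun _ => ℕ) k 0))
    (by rw [Fin.sum_cons, Fin.sum_snoc, h]; simp)

theorem add_le_sum {n m : ℕ} (k : Fin n → ℕ) (h : ∑ i, k i = m) (j : Fin n) :
    ∑ i ∈ Finset.univ.filter (· < j), k i + k j ≤ m := by
  rw [← h, add_comm, ← Finset.sum_insert (by simp)]
  exact Finset.sum_le_sum_of_subset (Finset.subset_univ _)

/-- The inert morphism `ρ_j : ⟪k₁ + ⋯ + kₙ⟫ → ⟪k_j⟫`: with `o = k₁ + ⋯ + k_{j-1}`, it sends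
`i ≤ o` to `-∞`, `o + s` to `s` for `1 ≤ s ≤ k_j`, and `i ≥ o + k_j + 1` to `∞`. -/
def rho {n m l : ℕ} (k : Fin n → ℕ) (h : ∑ i, k i = m) (j : Fin n) (hl : k j = l) :
    (⟨m⟩ : Nabla) ⟶ ⟨l⟩ :=
  show BoundedOrderHom (Fin (m + 2)) (Fin (l + 2)) from
  { toFun := fun i =>
      ⟨min ((i : ℕ) - ∑ i' ∈ Finset.univ.filter (· < j), k i') (l + 1), by omega⟩
    monotone' := by
      intro i i' hi
      rw [Fin.le_def] at hi ⊢
      dsimp only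
      omega
    map_bot' := by
      apply Fin.ext
      change min (0 - _) (l + 1) = 0
      omega
    map_top' := by
      apply Fin.ext
      have := add_le_sum k h j
      change min (m + 1 - _) (l + 1) = l + 1
      omega }

end Nabla

namespace CrossedGroup

/-- The action of `G_n` on `⟪n⟫ = ∇(⟪1⟫, ⟪n⟫)`. -/
def actPt (G : CrossedIntervalGroup.{u}) {n : ℕ} (x : G.obj ⟨n⟩) (j : Fin (n + 2)) : Fin (n + 2) :=
  Nabla.fn (G.act x (Nabla.pt (b := ⟨n⟩) j)) (1 : Fin 3)

theorem actPt_mul (G : CrossedIntervalGroup.{u}) {n : ℕ} (x y : G.obj ⟨n⟩) (j : Fin (n + 2)) :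
    G.actPt (x * y) j = G.actPt x (G.actPt y j) := by
  unfold actPt
  rw [Nabla.pt_fn_one, G.mul_act]

theorem actPt_one (G : CrossedIntervalGroup.{u}) {n : ℕ} (j : Fin (n + 2)) :
    G.actPt (1 : G.obj ⟨n⟩) j = j := by
  unfold actPt
  rw [G.one_act, Nabla.fn_pt]

theorem actPt_mid (G : CrossedIntervalGroup.{u}) {n : ℕ} (x : G.obj ⟨n⟩) (i : Fin n) :
    ∃ i', G.actPt x (mid i) = mid i' := by
  have key : ∀ (y : G.obj ⟨n⟩) (j : Fin (n + 2)), Nabla.FactorsZero (Nabla.pt (b := ⟨n⟩) j) →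
      Nabla.FactorsZero (Nabla.pt (b := ⟨n⟩) (G.actPt y j)) := by
    rintro y j ⟨f, g, h⟩
    refine ⟨G.act (G.map g y) f, G.act y g, ?_⟩
    rw [← G.comp_act, ← h]
    exact Nabla.pt_fn_one _
  by_contra hne
  have h1 : G.actPt x (mid i) = 0 ∨ G.actPt x (mid i) = Fin.last (n + 1) := by
    rcases mid_cases (G.actPt x (mid i)) with h | h | h
    · exact Or.inl h
    · exact Or.inr h
    · exact absurd h hne
  have h2 := key x⁻¹ _ ((Nabla.factorsZero_pt (b := ⟨n⟩) _).2 h1)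
  rw [← actPt_mul, inv_mul_cancel, actPt_one, Nabla.factorsZero_pt] at h2
  have := i.2
  rcases h2 with h2 | h2
  · have := congrArg Fin.val h2
    simp [mid_val] at this
  · have := congrArg Fin.val h2
    simp [mid_val] at this
    omega

theorem mid_injective {n : ℕ} : Function.Injective (mid (n := n)) := by
  intro i j h
  have := congrArg Fin.val h
  simp only [mid_val] at this
  exact Fin.ext (by omega)

/-- The action of `x ∈ G_n` on `⟨n⟩ = {1, …, n} ⊂ ⟪n⟫ = ∇(⟪1⟫, ⟪n⟫)`, as a permutation. -/
noncomputable def perm (G : CrossedIntervalGroup.{u}) {n : ℕ} (x : G.obj ⟨n⟩) :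
    Equiv.Perm (Fin n) where
  toFun i := (G.actPt_mid x i).choose
  invFun i := (G.actPt_mid x⁻¹ i).choose
  left_inv i := by
    apply mid_injective
    rw [← (G.actPt_mid x⁻¹ _).choose_spec, ← (G.actPt_mid x i).choose_spec, ← actPt_mul,
      inv_mul_cancel, actPt_one]
  right_inv i := by
    apply mid_injective
    rw [← (G.actPt_mid x _).choose_spec, ← (G.actPt_mid x⁻¹ i).choose_spec, ← actPt_mul,
      mul_inv_cancel, actPt_one]

/-- The permutation `G.perm x` is determined by `(i)ˣ = x(i)` in `∇(⟪1⟫, ⟪n⟫)`. -/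
theorem act_pt (G : CrossedIntervalGroup.{u}) {n : ℕ} (x : G.obj ⟨n⟩) (i : Fin n) :
    G.act x (Nabla.pt (b := ⟨n⟩) (mid i)) = Nabla.pt (b := ⟨n⟩) (mid (G.perm x i)) := by
  have := (G.actPt_mid x i).choose_spec
  rw [← Nabla.pt_fn_one (G.act x (Nabla.pt (b := ⟨n⟩) (mid i)))]
  exact congrArg _ this

/-- A crossed interval group is operadic if its elements act trivially on inert morphisms, and
if, for dissociated inert morphisms `ρ₁`, `ρ₂` with the same domain, the elements of the image of
`ρ₁*` commute with those of the image of `ρ₂*`. -/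
structure IsOperadic (G : CrossedIntervalGroup.{u}) : Prop where
  act_inert {n k : ℕ} (ρ : (⟨n⟩ : Nabla) ⟶ ⟨k⟩) (hρ : Nabla.IsInert ρ) (x : G.obj ⟨k⟩) :
    G.act x ρ = ρ
  commute {n k₁ k₂ : ℕ} (ρ₁ : (⟨n⟩ : Nabla) ⟶ ⟨k₁⟩) (ρ₂ : (⟨n⟩ : Nabla) ⟶ ⟨k₂⟩)
    (h₁ : Nabla.IsInert ρ₁) (h₂ : Nabla.IsInert ρ₂) (h : Nabla.Dissociated ρ₁ ρ₂)
    (x₁ : G.obj ⟨k₁⟩) (x₂ : G.obj ⟨k₂⟩) :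
    G.map ρ₁ x₁ * G.map ρ₂ x₂ = G.map ρ₂ x₂ * G.map ρ₁ x₁

/-- A crossed interval group is tame if
`μ_k*(x) · ρ^{(k)}_i*(y) = ρ^{(x_* k)}_{x(i)}*(y) · μ_k*(x)` for `x ∈ G_n`, `y ∈ G_{k_i}`, where
`x_* k = (k_{x⁻¹(1)}, …, k_{x⁻¹(n)})`. -/
def IsTame (G : CrossedIntervalGroup.{u}) : Prop :=
  ∀ {n m : ℕ} (k : Fin n → ℕ) (h : ∑ i, k i = m) (x : G.obj ⟨n⟩) (i : Fin n) (y : G.obj ⟨k i⟩),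
    G.map (Nabla.mu k h) x * G.map (Nabla.rho k h i rfl) y =
      G.map (Nabla.rho (fun j => k ((G.perm x)⁻¹ j)) (sum_perm h (G.perm x)) (G.perm x i)
        (by simp)) y * G.map (Nabla.mu k h) x

/-- A crossed interval group lies over `𝔖` if it admits a map of crossed interval groups to `𝔖`
(such a map is unique, since `𝔖` is a subobject of the terminal crossed interval group). -/
def LiesOverSymm (G : CrossedIntervalGroup.{u}) : Prop := Nonempty (Hom G symmCrossed)

/-- The composition `γ(x; x₁, …, xₙ) = μ_k*(x) ρ₁*(x₁) ⋯ ρₙ*(xₙ)` of `𝒪_G`. -/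
def operadComp (G : CrossedIntervalGroup.{u}) {n m : ℕ} (k : Fin n → ℕ) (h : ∑ i, k i = m)
    (x : G.obj ⟨n⟩) (y : ∀ i, G.obj ⟨k i⟩) : G.obj ⟨m⟩ :=
  G.map (Nabla.mu k h) x * (List.ofFn fun i => G.map (Nabla.rho k h i rfl) (y i)).prod

end CrossedGroup

/-- The maps `𝒢(n) → G_n` underlying a map `Ψ̂(𝒢) → G` of crossed interval groups. -/
def levelMap {X : GroupOperad.{u}} {G : CrossedIntervalGroup.{u}} (f : PsiHat.obj X ⟶ G) (n : ℕ) :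
    X.obj n → G.obj ⟨n⟩ :=
  CrossedGroup.Hom.app f ⟨n⟩

end IntervalGroups

open CategoryTheory IntervalGroups

universe u

universe v

/-! Everything rests on two families of morphisms of `∇`: the active `μ_k` and the inert `ρ_i`. In
`Ψ̂(𝒢)` they recover the operad structure: `μ_k*(x) = γ(x; e, …, e)` (`pull_mu`) and `ρ_i*(y) = γ(e;
e, …, y, …, e)` (`pull_rho`).

Necessity. Tameness is a comparison of two ways to split `γ(x; e, …, y, …, e)` by the interchange
law, as `(x·e; e·y)` and as `(e·x; y·e)`. An inert morphism has one preimage over each inner point,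
so permutations fix it. An inert morphism amounts to an interval of consecutive points of its
domain; if two such intervals are disjoint, the pulled back elements sit in different arguments of
`γ(e; …)` and commute. Dissociated inert morphisms may escape this case in one way only: one of them
has target `⟪0⟫` and cuts the interval of the other in its interior. Then commutation amounts to the
centrality of elements pulled back from `G_0`, which follows from tameness alone
(`IsTame.map_zero_mul`).

Sufficiency. By the commutation axiom, `(x₁, …, xₙ) ↦ ρ₁*(x₁) ⋯ ρₙ*(xₙ)` is a group homomorphism
(`blockHom`), so an identity between such products needs to be checked on one coordinate only.
Tameness says that conjugation by `μ_k*(x)` permutes the blocks (`map_mu_mul_blockHom`), which is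
the interchange law. For associativity one pulls a product back along `μ_l`; the twist in the
crossed product rule is harmless because a block product permutes points inside the fibres of `μ_k`
only. This uses that `G` acts through `𝔖`. Finally every `φ` is an inert morphism followed by an
active one (`rho_comp_mu`), so the presheaf structure of `G` is the one that `Ψ̂` builds from the
composition. -/

namespace IntervalGroups

/-! ### Values of `μ_k` and `ρ_j` on the points of each block. -/

namespace Nabla

theorem hom_ext_mid {m n : ℕ} {φ ψ : (⟨m⟩ : Nabla) ⟶ ⟨n⟩}
    (h : ∀ p : Fin m, fn φ (mid p) = fn ψ (mid p)) : φ = ψ := by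
  refine hom_ext fun j => ?_
  rcases mid_cases (n := m) j with rfl | rfl | ⟨i, rfl⟩
  · exact (fn_zero φ).trans (fn_zero ψ).symm
  · exact (fn_last φ).trans (fn_last ψ).symm
  · exact h i

theorem sum_filter_lt_mid {n : ℕ} (f : Fin (n + 2) → ℕ) (i : Fin n) :
    ∑ j ∈ Finset.univ.filter (· < mid i), f j =
      f 0 + ∑ j ∈ Finset.univ.filter (· < i), f (mid j) := by
  rw [Finset.sum_filter, sum_ends, Finset.sum_filter]
  have h0 : (0 : Fin (n + 2)) < mid i := by
    rw [Fin.lt_def, mid_val]; exact Nat.succ_pos _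
  have h1 : ¬ Fin.last (n + 1) < mid i := by simp [Fin.le_last]
  have h2 : ∀ j : Fin n, mid j < mid i ↔ j < i := by
    intro j; rw [Fin.lt_def, Fin.lt_def, mid_val, mid_val]; omega
  simp only [h0, h1, h2, if_true, if_false, add_zero]

theorem muVec_mid {n : ℕ} (k : Fin n → ℕ) (i : Fin n) :
    (Fin.cons 0 (Fin.snoc (α := fun _ => ℕ) k 0) : Fin (n + 2) → ℕ) (mid i) = k i := by
  simp [mid]

theorem muVec_last {n : ℕ} (k : Fin n → ℕ) :
    (Fin.cons 0 (Fin.snoc (α := fun _ => ℕ) k 0) : Fin (n + 2) → ℕ) (Fin.last (n + 1)) = 0 := by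
  simp [← Fin.succ_last]

theorem vec_mu_zero {n m : ℕ} (k : Fin n → ℕ) (h : ∑ i, k i = m) : vec (mu k h) 0 = 0 :=
  vec_ofVec _ _ _

theorem vec_mu_mid {n m : ℕ} (k : Fin n → ℕ) (h : ∑ i, k i = m) (i : Fin n) :
    vec (mu k h) (mid i) = k i :=
  (vec_ofVec _ _ _).trans (muVec_mid k i)

theorem vec_mu_last {n m : ℕ} (k : Fin n → ℕ) (h : ∑ i, k i = m) :
    vec (mu k h) (Fin.last (n + 1)) = 0 :=
  (vec_ofVec _ _ _).trans (muVec_last k)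

theorem fn_mu_blk {n m : ℕ} (k : Fin n → ℕ) (h : ∑ i, k i = m) (i : Fin n) (s : Fin (k i)) :
    fn (mu k h) (mid (blk k h i s)) = mid i := by
  set k' : Fin (n + 2) → ℕ := Fin.cons 0 (Fin.snoc (α := fun _ => ℕ) k 0)
  have h' : ∑ j, k' j = m := by rw [Fin.sum_cons, Fin.sum_snoc, h]; simp
  have hi : k i = k' (mid i) + bd (mid i) := by rw [bd_mid]; exact (muVec_mid k i).symm
  -- `ofVec` works with the blocks of all of `⟪m⟫`, where `-∞` forms a block of size one; this
  -- shifts positions by one, exactly as `mid` does.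
  have e : mid (blk k h i s) = blk (fun j => k' j + bd j) (sum_add_bd h') (mid i) (Fin.cast hi s) := by
    apply Fin.ext
    rw [mid_val, blk_val, blk_val, sum_filter_lt_mid, bd_zero]
    have : ∀ j, k' (mid j) + bd (mid j) = k j := fun j => by rw [bd_mid]; exact muVec_mid k j
    simp only [this, Fin.val_cast]
    have : k' 0 = 0 := rfl
    omega
  rw [e]
  exact blkIdx_blk (fun j => k' j + bd j) (sum_add_bd h') (mid i) (Fin.cast hi s)

theorem fn_rho_val {n m l : ℕ} (k : Fin n → ℕ) (h : ∑ i, k i = m) (j : Fin n) (hl : k j = l)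
    (p : Fin (m + 2)) : (fn (rho k h j hl) p : ℕ) =
      min ((p : ℕ) - ∑ i' ∈ Finset.univ.filter (· < j), k i') (l + 1) := rfl

theorem sum_filter_lt_add_le {n : ℕ} (k : Fin n → ℕ) {i j : Fin n} (hij : i < j) :
    ∑ x ∈ Finset.univ.filter (· < i), k x + k i ≤ ∑ x ∈ Finset.univ.filter (· < j), k x := by
  rw [add_comm, ← Finset.sum_insert (by simp)]
  refine Finset.sum_le_sum_of_subset ?_
  intro x hx
  simp only [Finset.mem_insert, Finset.mem_filter, Finset.mem_univ, true_and] at hx ⊢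
  rcases hx with rfl | hx
  · exact hij
  · exact hx.trans hij

theorem fn_rho_blk_of_lt {n m l : ℕ} (k : Fin n → ℕ) (h : ∑ i, k i = m) {i j : Fin n}
    (hl : k j = l) (hij : i < j) (s : Fin (k i)) :
    fn (rho k h j hl) (mid (blk k h i s)) = 0 := by
  apply Fin.ext
  rw [fn_rho_val, mid_val, blk_val]
  have := sum_filter_lt_add_le k hij
  have := s.2
  change _ = 0
  omega

theorem fn_rho_blk_of_gt {n m l : ℕ} (k : Fin n → ℕ) (h : ∑ i, k i = m) {i j : Fin n}
    (hl : k j = l) (hij : j < i) (s : Fin (k i)) :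
    fn (rho k h j hl) (mid (blk k h i s)) = Fin.last (l + 1) := by
  apply Fin.ext
  rw [fn_rho_val, mid_val, blk_val]
  have := sum_filter_lt_add_le k hij
  change _ = l + 1
  omega

theorem fn_rho_blk_self {n m l : ℕ} (k : Fin n → ℕ) (h : ∑ i, k i = m) (j : Fin n)
    (hl : k j = l) (s : Fin (k j)) :
    fn (rho k h j hl) (mid (blk k h j s)) = mid (Fin.cast hl s) := by
  apply Fin.ext
  rw [fn_rho_val, mid_val, mid_val, blk_val, Fin.val_cast]
  have := s.2
  omega

theorem blk_one {n : ℕ} (h : ∑ _i : Fin n, 1 = n) (i : Fin n) (s : Fin 1) :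
    blk (fun _ => 1) h i s = i := by
  apply Fin.ext
  rw [blk_val]
  have : Finset.univ.filter (fun x => x < i) = Finset.Iio i := by ext; simp
  simp [Subsingleton.elim s 0, this]

theorem mu_one {n : ℕ} (h : ∑ _i : Fin n, 1 = n) : mu (fun _ : Fin n => 1) h = 𝟙 _ := by
  refine hom_ext_mid fun p => ?_
  have := fn_mu_blk (fun _ : Fin n => 1) h p (0 : Fin 1)
  rw [blk_one] at this
  exact this

theorem rho_fin_one {m : ℕ} (h : ∑ _i : Fin 1, m = m) (j : Fin 1) :
    rho (fun _ : Fin 1 => m) h j rfl = 𝟙 _ := by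
  refine hom_ext fun p => Fin.ext ?_
  have : Finset.univ.filter (fun x => x < j) = ∅ := by
    ext x; simp [Subsingleton.elim x j]
  rw [fn_rho_val, this, Finset.sum_empty]
  have : (p : ℕ) < m + 2 := p.2
  change min ((p : ℕ) - 0) (m + 1) = p
  omega

theorem permAct_mu {n m : ℕ} (τ : Equiv.Perm (Fin n)) (k : Fin n → ℕ) (h : ∑ i, k i = m) :
    permAct (b := ⟨n⟩) τ (mu k h) = mu (fun i => k (τ⁻¹ i)) (sum_perm h τ) := by
  refine hom_ext_vec fun j => ?_
  rw [vec_permAct, ext_inv]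
  rcases mid_cases (n := n) j with rfl | rfl | ⟨i, rfl⟩
  · rw [ext_zero, vec_mu_zero, vec_mu_zero]
  · rw [ext_last, vec_mu_last, vec_mu_last]
  · rw [ext_mid, vec_mu_mid, vec_mu_mid]

theorem permAct_pt {n : ℕ} (τ : Equiv.Perm (Fin n)) (i : Fin n) :
    permAct (b := ⟨n⟩) τ (pt (b := ⟨n⟩) (mid i)) = pt (b := ⟨n⟩) (mid (τ i)) := by
  rw [← pt_fn_one (permAct (b := ⟨n⟩) τ (pt (b := ⟨n⟩) (mid i)))]
  congr 1
  -- The square gives the value at some point `q` of `⟪1⟫`. Since that value is an inner point, `q`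
  -- is not `±∞` and must be the inner point of `⟪1⟫`.
  have key := fn_permAct (b := ⟨n⟩) τ (pt (b := ⟨n⟩) (mid i)) (1 : Fin 3)
  rw [fn_pt, ext_mid] at key
  generalize permComp _ _ _ _ (1 : Fin 3) = q at key
  rcases mid_cases (n := 1) q with rfl | rfl | ⟨j, rfl⟩
  · rw [fn_zero] at key
    exact absurd (congrArg Fin.val key) (by simp [mid_val])
  · have key := congrArg Fin.val ((fn_last _).symm.trans key)
    have := (τ i).2
    simp only [mid_val, Fin.val_last] at key
    omega
  · rwa [Subsingleton.elim j 0] at key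

end Nabla

/-! ### Relations between the `μ` and `ρ`, and the classification of inert morphisms. -/

namespace Nabla

/-- This and the next two relations are the associativity of `γ` inside `∇`. In `γ(γ(x; y); z)` they
govern the factors coming from `x`, from the `y_i` and from the `z_p` respectively. -/
theorem mu_comp_mu {n m r : ℕ} (k : Fin n → ℕ) (h : ∑ i, k i = m) (l : Fin m → ℕ)
    (h' : ∑ p, l p = r) (h'' : ∑ i, ∑ s, l (blk k h i s) = r) :
    mu l h' ≫ mu k h = mu (fun i => ∑ s, l (blk k h i s)) h'' := by
  refine hom_ext_mid fun p => ?_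
  obtain ⟨q, t, rfl⟩ := blk_surj l h' p
  obtain ⟨i, s, rfl⟩ := blk_surj k h q
  refine ((congrArg (fn (mu k h)) (fn_mu_blk l h' _ t)).trans (fn_mu_blk k h i s)).trans ?_
  rw [← blk_blk k h l h' h'', fn_mu_blk]

theorem mu_comp_rho {n m r : ℕ} (k : Fin n → ℕ) (h : ∑ i, k i = m) (l : Fin m → ℕ)
    (h' : ∑ p, l p = r) (h'' : ∑ i, ∑ s, l (blk k h i s) = r) (i : Fin n) :
    mu l h' ≫ rho k h i rfl =
      rho (fun i => ∑ s, l (blk k h i s)) h'' i rfl ≫ mu (fun s => l (blk k h i s)) rfl := by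
  refine hom_ext_mid fun p => ?_
  obtain ⟨q, t, rfl⟩ := blk_surj l h' p
  obtain ⟨j, s, rfl⟩ := blk_surj k h q
  rw [fn_comp, fn_comp]
  erw [fn_mu_blk]
  rw [← blk_blk k h l h' h'']
  rcases lt_trichotomy j i with hj | rfl | hj
  · erw [fn_rho_blk_of_lt _ _ _ hj, fn_rho_blk_of_lt _ _ _ hj, fn_zero]
  · erw [fn_rho_blk_self, fn_rho_blk_self]
    exact (fn_mu_blk (fun s => l (blk k h j s)) rfl s t).symm
  · erw [fn_rho_blk_of_gt _ _ _ hj, fn_rho_blk_of_gt _ _ _ hj, fn_last]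

theorem rho_comp_rho {n m r : ℕ} (k : Fin n → ℕ) (h : ∑ i, k i = m) (l : Fin m → ℕ)
    (h' : ∑ p, l p = r) (h'' : ∑ i, ∑ s, l (blk k h i s) = r) (i : Fin n) (s : Fin (k i)) :
    rho (fun i => ∑ s, l (blk k h i s)) h'' i rfl ≫ rho (fun s => l (blk k h i s)) rfl s rfl =
      rho l h' (blk k h i s) rfl := by
  refine hom_ext_mid fun p => ?_
  obtain ⟨q, t', rfl⟩ := blk_surj l h' p
  obtain ⟨j, s', rfl⟩ := blk_surj k h q
  rw [fn_comp]
  conv_lhs => rw [← blk_blk k h l h' h'']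
  rcases lt_trichotomy j i with hj | rfl | hj
  · erw [fn_rho_blk_of_lt _ _ _ hj, fn_zero,
      fn_rho_blk_of_lt _ _ _ ((blk_lt_iff k h j i s' s).2 (Or.inl hj))]
  · erw [fn_rho_blk_self]
    rcases lt_trichotomy s' s with hs | rfl | hs
    · have := (blk_lt_iff k h j j s' s).2 (Or.inr ⟨rfl, hs⟩)
      erw [fn_rho_blk_of_lt _ _ _ this, fn_rho_blk_of_lt _ _ _ hs]
    · erw [fn_rho_blk_self, fn_rho_blk_self]
    · have := (blk_lt_iff k h j j s s').2 (Or.inr ⟨rfl, hs⟩)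
      erw [fn_rho_blk_of_gt _ _ _ this, fn_rho_blk_of_gt _ _ _ hs]
  · erw [fn_rho_blk_of_gt _ _ _ hj, fn_last,
      fn_rho_blk_of_gt _ _ _ ((blk_lt_iff k h i j s s').2 (Or.inl hj))]

/-- A permutation that moves points only within the fibres of `φ` merely reorders the summands in
each fibre cardinality of the composite. The crossed twist is removed in this way whenever a block
product is pulled back. -/
theorem permAct_comp_of_fixed {a b c : Nabla} (ψ : a ⟶ b) (φ : b ⟶ c)
    (τ : Equiv.Perm (Fin b.len)) (hτ : ∀ p, fn φ (ext τ p) = fn φ p) :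
    permAct τ ψ ≫ φ = ψ ≫ φ := by
  refine hom_ext_card fun j => ?_
  rw [card_comp, card_comp]
  refine Finset.sum_bij (fun i _ => (ext τ)⁻¹ i) ?_ ?_ ?_ ?_
  · intro i hi
    have hi := (Finset.mem_filter.1 hi).2
    refine Finset.mem_filter.2 ⟨Finset.mem_univ _, ?_⟩
    rw [← hτ]
    simpa using hi
  · intro i _ i' _ h
    exact (ext τ)⁻¹.injective h
  · intro i hi
    have hi := (Finset.mem_filter.1 hi).2
    refine ⟨ext τ i, Finset.mem_filter.2 ⟨Finset.mem_univ _, ?_⟩, by simp⟩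
    rw [hτ, hi]
  · intro i _
    rw [card_permAct]

theorem vec_rho_mid {n m l : ℕ} (k : Fin n → ℕ) (h : ∑ i, k i = m) (j : Fin n) (hl : k j = l)
    (s : Fin l) : vec (rho k h j hl) (mid s) = 1 := by
  subst hl
  rw [vec, bd_mid, Nat.sub_zero, card, Finset.card_eq_one]
  refine ⟨mid (blk k h j s), ?_⟩
  ext p
  simp only [Finset.mem_filter, Finset.mem_univ, true_and, Finset.mem_singleton]
  rw [← Fin.val_inj, fn_rho_val, ← Fin.val_inj, mid_val, mid_val, blk_val]
  have := s.2
  omega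

theorem vec_rho_zero {n m l : ℕ} (k : Fin n → ℕ) (h : ∑ i, k i = m) (j : Fin n) (hl : k j = l) :
    vec (rho k h j hl) 0 = ∑ i ∈ Finset.univ.filter (· < j), k i := by
  have hj := add_le_sum k h j
  rw [vec, bd_zero, card]
  have : Finset.univ.filter (fun p => fn (rho k h j hl) p = 0) =
      Finset.Iic (⟨∑ i ∈ Finset.univ.filter (· < j), k i, by omega⟩ : Fin (m + 2)) := by
    ext p
    simp only [Finset.mem_filter, Finset.mem_univ, true_and, Finset.mem_Iic]
    rw [← Fin.val_inj, fn_rho_val, Fin.le_def]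
    change _ = 0 ↔ _
    dsimp only
    omega
  erw [this, Fin.card_Iic]
  simp

theorem fn_mu_mid_ne {n m : ℕ} (k : Fin n → ℕ) (h : ∑ i, k i = m) (p : Fin m) :
    fn (mu k h) (mid p) ≠ 0 := by
  obtain ⟨i, s, rfl⟩ := blk_surj k h p
  rw [fn_mu_blk]
  simp [Fin.ext_iff, mid_val]

theorem vec_comp_mu_zero {a : Nabla} {n m : ℕ} (k : Fin n → ℕ) (h : ∑ i, k i = m)
    (ψ : a ⟶ ⟨m⟩) : vec (ψ ≫ mu k h) 0 = vec ψ 0 := by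
  rw [vec_comp, sum_blk, Finset.sum_filter]
  refine (sum_ends _).trans ?_
  rw [if_pos (fn_zero _), if_neg, Finset.sum_eq_zero]
  · rfl
  · exact fun i _ => if_neg (fn_mu_mid_ne k h i)
  · erw [fn_last]
    simp [Fin.ext_iff]

theorem vec_comp_mu_mid {a : Nabla} {n m : ℕ} (k : Fin n → ℕ) (h : ∑ i, k i = m)
    (ψ : a ⟶ ⟨m⟩) (hψ : ∀ i, vec ψ (mid i) = 1) (j : Fin n) :
    vec (ψ ≫ mu k h) (mid j) = k j := by
  have hj := j.2
  have h0 : fn (mu k h) 0 ≠ mid j := by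
    rw [fn_zero]
    simp [Fin.ext_iff, mid_val]
  have h1 : fn (mu k h) (Fin.last _) ≠ mid j := by
    rw [fn_last]
    simp [Fin.ext_iff, mid_val]
    omega
  have hc : card (mu k h) (mid j) = k j := by
    rw [card_eq, vec_mu_mid, bd_mid, add_zero]
  rw [card, Finset.card_filter] at hc
  rw [vec_comp, sum_blk, Finset.sum_filter, ← hc]
  refine (sum_ends _).trans ((sum_ends _).trans ?_).symm
  rw [if_neg h0, if_neg h1, if_neg h0, if_neg h1]
  exact congrArg (fun t => 0 + t + 0) (Finset.sum_congr rfl fun i _ =>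
    if_congr Iff.rfl (hψ i).symm rfl)

/-- With this numerical form, the only freedom left in an inert morphism is the number of points
sent to `-∞`. -/
theorem isInert_iff_vec {a b : Nabla} (φ : a ⟶ b) :
    IsInert φ ↔ ∀ i, vec φ (mid i) = 1 := by
  have hc : ∀ i, vec φ (mid i) = card φ (mid i) := fun i => by rw [vec, bd_mid]; rfl
  simp only [hc, card, Finset.card_eq_one]
  constructor
  · intro h i
    obtain ⟨p, hp, hpi⟩ := h.surjOn ⟨i, rfl⟩
    refine ⟨p, ?_⟩
    ext q
    simp only [Finset.mem_filter, Finset.mem_univ, true_and, Finset.mem_singleton]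
    exact ⟨fun hq => h.injOn ⟨i, hq.symm⟩ hp (hq.trans hpi.symm), fun hq => hq ▸ hpi⟩
  · intro h
    refine ⟨fun p hp => hp, ?_, ?_⟩
    · rintro p ⟨i, hi⟩ q - hpq
      obtain ⟨r, hr⟩ := h i
      have hp : p ∈ ({r} : Finset _) := hr ▸ by simp [hi]
      have hq : q ∈ ({r} : Finset _) := hr ▸ by simp [hi, hpq]
      rw [Finset.mem_singleton.1 hp, Finset.mem_singleton.1 hq]
    · rintro _ ⟨i, rfl⟩
      obtain ⟨r, hr⟩ := h i
      have : r ∈ Finset.univ.filter (fun p => fn φ p = mid i) := hr ▸ Finset.mem_singleton_self r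
      have := (Finset.mem_filter.1 this).2
      exact ⟨r, ⟨i, this.symm⟩, this⟩

theorem isInert_rho {n m l : ℕ} (k : Fin n → ℕ) (h : ∑ i, k i = m) (j : Fin n) (hl : k j = l) :
    IsInert (rho k h j hl) :=
  (isInert_iff_vec _).2 (vec_rho_mid k h j hl)

theorem hom_ext_vec_of_zero_of_mid {a b : Nabla} {φ ψ : a ⟶ b} (h0 : vec φ 0 = vec ψ 0)
    (h : ∀ i, vec φ (mid i) = vec ψ (mid i)) : φ = ψ := by
  have h1 := (sum_ends (vec φ)).symm.trans (sum_vec φ)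
  have h2 := (sum_ends (vec ψ)).symm.trans (sum_vec ψ)
  simp only [h, h0] at h1
  -- The entries of both vectors add up to the length of the domain, so the entry at `∞` is forced
  -- by the others.
  refine hom_ext_vec fun j => ?_
  rcases mid_cases (n := b.len) j with rfl | rfl | ⟨i, rfl⟩
  · exact h0
  · exact Nat.add_left_cancel (h1.trans h2.symm)
  · exact h i

theorem IsInert.ext {a b : Nabla} {φ ψ : a ⟶ b} (hφ : IsInert φ) (hψ : IsInert ψ)
    (h0 : vec φ 0 = vec ψ 0) : φ = ψ :=
  hom_ext_vec_of_zero_of_mid h0 fun i =>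
    ((isInert_iff_vec φ).1 hφ i).trans ((isInert_iff_vec ψ).1 hψ i).symm

theorem IsInert.eq_rho {n m l : ℕ} {φ : (⟨m⟩ : Nabla) ⟶ ⟨l⟩} (hφ : IsInert φ) (k : Fin n → ℕ)
    (h : ∑ i, k i = m) (j : Fin n) (hl : k j = l)
    (h0 : vec φ 0 = ∑ i ∈ Finset.univ.filter (· < j), k i) : φ = rho k h j hl :=
  hφ.ext (isInert_rho k h j hl) (by rw [h0, vec_rho_zero])

theorem vec_add_le {m l : ℕ} {φ : (⟨m⟩ : Nabla) ⟶ ⟨l⟩} (hφ : IsInert φ) :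
    vec φ 0 + l ≤ m := by
  rw [isInert_iff_vec] at hφ
  have h1 := (sum_ends (vec φ)).symm.trans (sum_vec φ)
  simp only [hφ] at h1
  change _ = m at h1
  simp at h1
  change _ + l + _ = m at h1
  omega

theorem IsInert.fn_val {m l : ℕ} {φ : (⟨m⟩ : Nabla) ⟶ ⟨l⟩} (hφ : IsInert φ) (p : Fin (m + 2)) :
    (fn φ p : ℕ) = min ((p : ℕ) - vec φ 0) (l + 1) := by
  have hle := vec_add_le hφ
  -- Three blocks: the points sent to `-∞`, those mapped onto the inner points, and those sent to
  -- `∞`. The inert morphism is `ρ` for the middle block.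
  have h : ∑ i, (![vec φ 0, l, m - (vec φ 0 + l)] : Fin 3 → ℕ) i = m := by
    rw [Fin.sum_univ_three]
    change vec φ 0 + l + (m - (vec φ 0 + l)) = m
    omega
  have e : Finset.univ.filter (fun j : Fin 3 => j < 1) = {0} := rfl
  have h0 : vec φ 0 = ∑ i ∈ Finset.univ.filter (fun j : Fin 3 => j < 1),
      (![vec φ 0, l, m - (vec φ 0 + l)] : Fin 3 → ℕ) i := by
    rw [e, Finset.sum_singleton]; rfl
  conv_lhs => rw [hφ.eq_rho ![vec φ 0, l, m - (vec φ 0 + l)] h 1 rfl h0]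
  refine (fn_rho_val _ h 1 rfl p).trans ?_
  rw [← h0]
  rfl

/-- The inert-active factorization: the inert factor collapses the points that `φ` sends to `±∞`,
and the active one distributes the remaining points. Through it, knowledge of the pullbacks along
`μ` and `ρ` suffices for all morphisms. -/
theorem rho_comp_mu {a b : Nabla} (φ : a ⟶ b)
    (h : ∑ i, (![vec φ 0, ∑ i, vec φ (mid i), vec φ (Fin.last _)] : Fin 3 → ℕ) i = a.len) :
    rho (m := a.len) ![vec φ 0, ∑ i, vec φ (mid i), vec φ (Fin.last _)] h 1 rfl ≫
      mu (n := b.len) (fun i => vec φ (mid i)) rfl = φ := by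
  have e : Finset.univ.filter (fun j : Fin 3 => j < 1) = {0} := rfl
  refine hom_ext_vec_of_zero_of_mid ?_ ?_
  · refine (vec_comp_mu_zero _ _ _).trans ((vec_rho_zero _ h 1 rfl).trans ?_)
    rw [e, Finset.sum_singleton]
    rfl
  · exact vec_comp_mu_mid _ _ _ (vec_rho_mid _ h 1 rfl)

theorem factorsZero_iff {b : Nabla} (φ : (⟨1⟩ : Nabla) ⟶ b) :
    FactorsZero φ ↔ fn φ (1 : Fin 3) = 0 ∨ fn φ (1 : Fin 3) = Fin.last (b.len + 1) := by
  conv_lhs => rw [← pt_fn_one φ]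
  exact factorsZero_pt _

theorem dissociated_iff {a b c : Nabla} (φ₁ : a ⟶ b) (φ₂ : a ⟶ c) :
    Dissociated φ₁ φ₂ ↔ ∀ p, (fn φ₁ p = 0 ∨ fn φ₁ p = Fin.last (b.len + 1)) ∨
      (fn φ₂ p = 0 ∨ fn φ₂ p = Fin.last (c.len + 1)) := by
  simp only [Dissociated, factorsZero_iff]
  exact ⟨fun h p => h (pt p), fun h α => h (fn α (1 : Fin 3))⟩

theorem dissociated_rho {n m : ℕ} (k : Fin n → ℕ) (h : ∑ i, k i = m) {i j : Fin n} (hij : i ≠ j) :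
    Dissociated (rho k h i rfl) (rho k h j rfl) := by
  rw [dissociated_iff]
  intro p
  simp only [← Fin.val_inj]
  rw [fn_rho_val, fn_rho_val]
  change (_ = 0 ∨ _ = k i + 1) ∨ (_ = 0 ∨ _ = k j + 1)
  rcases lt_or_gt_of_ne hij with hlt | hlt
  · have := sum_filter_lt_add_le k hlt
    omega
  · have := sum_filter_lt_add_le k hlt
    omega

end Nabla

/-! ### Pullbacks along `μ` and `ρ` in `Ψ̂(𝒢)`. -/

namespace GroupOperad

open Nabla

variable (X : GroupOperad.{u})

theorem pull_mu {n m : ℕ} (k : Fin n → ℕ) (h : ∑ i, k i = m) (x : X.obj n) :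
    X.pull (mu k h) x = X.comp k h x 1 := by
  refine Eq.trans ?_ (X.ins_zero _)
  exact X.ins_congr (vec_mu_zero k h) (vec_mu_last k h)
    (X.comp_one_hcongr (funext (vec_mu_mid k h)) x)

theorem sum_blk_head {n i c : ℕ} (hs : ∑ j, (![i, 1, c] : Fin 3 → ℕ) j = n) (f : Fin n → ℕ)
    (q : Fin n) (hq : (q : ℕ) = i) :
    ∑ s, f (blk ![i, 1, c] hs 0 s) = ∑ j ∈ Finset.univ.filter (· < q), f j := by
  have e0 : Finset.univ.filter (· < (0 : Fin 3)) = ∅ := rfl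
  have hv : ∀ s, (blk ![i, 1, c] hs 0 s : ℕ) = s := fun s => by
    rw [blk_val, e0]; simp
  refine Finset.sum_bij (fun s _ => blk ![i, 1, c] hs 0 s) ?_ ?_ ?_ ?_
  · intro s _
    refine Finset.mem_filter.2 ⟨Finset.mem_univ _, ?_⟩
    rw [Fin.lt_def, hv, hq]
    exact s.2
  · intro s _ t _ hst
    have := congrArg Fin.val hst
    rw [hv, hv] at this
    exact Fin.ext this
  · intro b hb
    have hb := (Finset.mem_filter.1 hb).2
    rw [Fin.lt_def, hq] at hb
    exact ⟨(⟨b, hb⟩ : Fin i), Finset.mem_univ _, Fin.ext (hv _)⟩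
  · intro s _; rfl

/-- Associativity allows the arguments before `i`, and those after `i`, to be merged into one unit
each, which turns the right side into `γ(e₃; e, y, e)`. The left side has this shape too, since its
inner composition is `γ(y; e₁, …, e₁) = y`. -/
theorem pull_rho {n m : ℕ} (k : Fin n → ℕ) (h : ∑ i, k i = m) (i : Fin n) (y : X.obj (k i)) :
    X.pull (rho k h i rfl) y =
      X.comp k h 1 (Pi.mulSingle (M := fun i => X.obj (k i)) i y) := by
  have hi := i.2
  -- The `n` arguments are grouped as those before `i`, `i` itself, and those after `i`; here `i`
  -- counts from zero.
  have hs : ∑ j, (![i, 1, n - i - 1] : Fin 3 → ℕ) j = n := by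
    rw [Fin.sum_univ_three]
    change (i : ℕ) + 1 + (n - i - 1) = n
    omega
  have e1 : Finset.univ.filter (· < (1 : Fin 3)) = {0} := rfl
  have hq : blk ![(i : ℕ), 1, n - i - 1] hs 1 (0 : Fin 1) = i := by
    refine Fin.ext ((blk_val _ hs 1 (0 : Fin 1)).trans ?_)
    rw [e1, Finset.sum_singleton]
    rfl
  have hA := sum_blk_head hs k i rfl
  have hN : ∑ s, k (blk ![(i : ℕ), 1, n - i - 1] hs 1 s) = k i :=
    (Fin.sum_univ_one (fun s : Fin 1 => k (blk ![(i : ℕ), 1, n - i - 1] hs 1 s))).trans (by rw [hq])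
  have hr : (∑ j ∈ Finset.univ.filter (· < i), k j) + k i +
      ∑ s, k (blk ![(i : ℕ), 1, n - i - 1] hs 2 s) = m := by
    rw [← hA, ← hN, ← h, ← Equiv.sum_comp (blkEquiv _ hs) k, Fintype.sum_sigma,
      Fin.sum_univ_three]
    rfl
  rw [X.regroup3' ![(i : ℕ), 1, n - i - 1] hs k h (0 : Fin 1) i hq y hA hN rfl hr y
    (fun x' hx' => (X.single_fin_one
      (k := fun s => k (blk ![(i : ℕ), 1, n - i - 1] hs 1 s)) x').trans hx')]
  have hv := sum_vec_mid (rho k h i rfl)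
  simp only [vec_rho_mid, vec_rho_zero] at hv
  change _ + ∑ s : Fin (k i), 1 + vec (rho k h i rfl) (Fin.last (k i + 1)) = m at hv
  rw [Finset.sum_const, Finset.card_univ, Fintype.card_fin, smul_eq_mul, mul_one] at hv
  refine X.ins_congr (vec_rho_zero k h i rfl) ?_ ?_
  · exact Nat.add_left_cancel (hv.trans hr.symm)
  · have h1 := X.comp_one y
    rw [one_eq] at h1
    refine HEq.trans ?_ (heq_of_eq h1)
    exact X.comp_one_hcongr (funext (vec_rho_mid k h i rfl)) y

end GroupOperad

/-! ### The action on points, and first consequences of tameness. -/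

namespace CrossedGroup

open Nabla

theorem perm_eq_of_act (G : CrossedIntervalGroup.{u}) {n : ℕ} (x : G.obj ⟨n⟩)
    (σ : Equiv.Perm (Fin n))
    (h : ∀ i, G.act x (pt (b := ⟨n⟩) (mid i)) = permAct (b := ⟨n⟩) σ (pt (b := ⟨n⟩) (mid i))) :
    G.perm x = σ := by
  apply Equiv.ext
  intro i
  have h1 := (G.act_pt x i).symm.trans ((h i).trans (permAct_pt σ i))
  exact mid_injective (congrArg (fun φ => fn φ (1 : Fin 3)) h1)

theorem Hom.perm_app {G : CrossedIntervalGroup.{u}} {H : CrossedIntervalGroup.{v}} (f : Hom G H)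
    {n : ℕ} (x : G.obj ⟨n⟩) : H.perm (f.app ⟨n⟩ x) = G.perm x := by
  apply Equiv.ext
  intro i
  have h1 := (H.act_pt (f.app ⟨n⟩ x) i).symm.trans ((f.act_app x _).trans (G.act_pt x i))
  exact mid_injective (congrArg (fun φ => fn φ (1 : Fin 3)) h1)

/-- `IsTame` with the length of the `i`-th block and the permutation as free variables. -/
theorem IsTame.map_mu_mul_map_rho {G : CrossedIntervalGroup.{u}} (hG : G.IsTame) {n m l : ℕ}
    (k : Fin n → ℕ) (h : ∑ i, k i = m) (x : G.obj ⟨n⟩) (i : Fin n) (hl : k i = l)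
    (y : G.obj ⟨l⟩) (σ : Equiv.Perm (Fin n)) (hσ : G.perm x = σ) (hl' : k (σ⁻¹ (σ i)) = l) :
    G.map (mu k h) x * G.map (rho k h i hl) y =
      G.map (rho (fun j => k (σ⁻¹ j)) (sum_perm h σ) (σ i) hl') y * G.map (mu k h) x := by
  subst hl hσ
  exact hG k h x i y

/-- The axioms are equations, so they may be tested after an injective map. This and its analogue
for tameness transport both properties along isomorphisms. -/
theorem IsOperadic.of_injective {G H : CrossedIntervalGroup.{u}} (hH : H.IsOperadic)
    (f : Hom G H) (hf : ∀ a, Function.Injective (f.app a)) : G.IsOperadic where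
  act_inert ρ hρ x := by rw [← f.act_app, hH.act_inert ρ hρ]
  commute ρ₁ ρ₂ h₁ h₂ h x₁ x₂ := by
    apply hf
    rw [f.app_mul, f.app_mul, f.app_map, f.app_map]
    exact hH.commute ρ₁ ρ₂ h₁ h₂ h _ _

theorem IsTame.of_injective {G H : CrossedIntervalGroup.{u}} (hH : H.IsTame)
    (f : Hom G H) (hf : ∀ a, Function.Injective (f.app a)) : G.IsTame := by
  intro n m k h x i y
  apply hf
  rw [f.app_mul, f.app_mul, f.app_map, f.app_map, f.app_map]
  exact hH.map_mu_mul_map_rho k h _ i rfl _ _ (f.perm_app x) _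

/-- For a single block of length one, `μ` and `ρ` are identities and tameness itself reads `xy =
yx`. -/
theorem IsTame.commute_one {G : CrossedIntervalGroup.{u}} (hG : G.IsTame) (x y : G.obj ⟨1⟩) :
    x * y = y * x := by
  have hs : ∑ _i : Fin 1, 1 = 1 := rfl
  have key := hG.map_mu_mul_map_rho (fun _ : Fin 1 => 1) hs x 0 rfl y _ rfl rfl
  rw [mu_one, rho_fin_one] at key
  erw [rho_fin_one] at key
  simpa only [G.map_id] using key

theorem IsTame.mul_map_rho {G : CrossedIntervalGroup.{u}} (hG : G.IsTame) {n : ℕ}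
    (h : ∑ _i : Fin n, 1 = n) (x : G.obj ⟨n⟩) (i : Fin n) (y : G.obj ⟨1⟩) :
    x * G.map (rho (fun _ => 1) h i rfl) y =
      G.map (rho (fun _ => 1) h (G.perm x i) rfl) y * x := by
  have key := hG.map_mu_mul_map_rho (fun _ : Fin n => 1) h x i rfl y _ rfl rfl
  rwa [mu_one, G.map_id] at key

end CrossedGroup

/-! ### Centrality of elements pulled back from `G_0`. -/

namespace Nabla

theorem isInert_zero {m : ℕ} (φ : (⟨m⟩ : Nabla) ⟶ ⟨0⟩) : IsInert φ :=
  (isInert_iff_vec φ).2 fun i => i.elim0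

/-- The morphism `⟪n⟫ → ⟪0⟫` that sends `1, …, a` to `-∞` and the rest to `∞`. -/
def cut {n : ℕ} (a : ℕ) (ha : a ≤ n) : (⟨n⟩ : Nabla) ⟶ ⟨0⟩ :=
  rho ![a, 0, n - a] (by
    rw [Fin.sum_univ_three]
    change a + 0 + (n - a) = n
    omega) 1 rfl

theorem vec_cut {n : ℕ} (a : ℕ) (ha : a ≤ n) : vec (cut a ha) 0 = a := by
  have e : Finset.univ.filter (fun j : Fin 3 => j < 1) = {0} := rfl
  refine (vec_rho_zero _ _ _ _).trans ?_
  rw [e, Finset.sum_singleton]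
  rfl

theorem fn_cut_val {n : ℕ} (a : ℕ) (ha : a ≤ n) (p : Fin (n + 2)) :
    (fn (cut a ha) p : ℕ) = min ((p : ℕ) - a) 1 := by
  rw [(isInert_zero _).fn_val, vec_cut]

theorem eq_cut {n : ℕ} (φ : (⟨n⟩ : Nabla) ⟶ ⟨0⟩) (a : ℕ) (ha : a ≤ n) (h : vec φ 0 = a) :
    φ = cut a ha :=
  (isInert_zero φ).ext (isInert_zero _) (h.trans (vec_cut a ha).symm)

theorem fn_rho_one_val {n : ℕ} (h : ∑ _i : Fin n, 1 = n) (i : Fin n) (p : Fin (n + 2)) :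
    (fn (rho (fun _ => 1) h i rfl) p : ℕ) = min ((p : ℕ) - i) 2 := by
  have : Finset.univ.filter (fun x => x < i) = Finset.Iio i := by ext; simp
  rw [fn_rho_val, this]
  simp

/-- The two cuts of `⟪1⟫`, before and after its inner point, pull back along `ρ_i` to the cuts of
`⟪n⟫` just before and just after the point `i`. Neighbouring cuts of `⟪n⟫` are thus linked through
`⟪1⟫`. -/
theorem rho_comp_cut_zero {n : ℕ} (h : ∑ _i : Fin n, 1 = n) (i : Fin n) :
    rho (fun _ => 1) h i rfl ≫ cut 0 (Nat.zero_le 1) = cut (i : ℕ) i.2.le := by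
  refine hom_ext fun p => Fin.ext ?_
  rw [fn_comp, fn_cut_val]
  erw [fn_cut_val, fn_rho_one_val]
  omega

theorem rho_comp_cut_one {n : ℕ} (h : ∑ _i : Fin n, 1 = n) (i : Fin n) :
    rho (fun _ => 1) h i rfl ≫ cut 1 le_rfl = cut ((i : ℕ) + 1) i.2 := by
  refine hom_ext fun p => Fin.ext ?_
  rw [fn_comp, fn_cut_val]
  erw [fn_cut_val, fn_rho_one_val]
  omega

end Nabla

/-- A permutation without inversions is an order automorphism of a finite chain, and the identity is
the only one. -/
theorem exists_inversion {n : ℕ} {σ : Equiv.Perm (Fin n)} (hσ : σ ≠ 1) :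
    ∃ i j, i < j ∧ σ j < σ i := by
  by_contra! hne
  have hs : StrictMono σ := fun i j hij =>
    lt_of_le_of_ne (hne i j hij) fun h => hij.ne (σ.injective h)
  apply hσ
  have := Subsingleton.elim (hs.orderIsoOfSurjective σ σ.surjective) (OrderIso.refl _)
  apply Equiv.ext
  intro i
  exact DFunLike.congr_fun this i

namespace CrossedGroup

open Nabla

/-- An inversion `i < j` of `x` carries an empty block `j` from after the only point, placed in
block `i`, to before it. Tameness then relates the two cuts of `⟪1⟫` by conjugation in `G_1`, which
is commutative. -/
theorem IsTame.map_cut_eq {G : CrossedIntervalGroup.{u}} (hG : G.IsTame) {n : ℕ}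
    {x : G.obj ⟨n⟩} (hx : G.perm x ≠ 1) (y : G.obj ⟨0⟩) :
    G.map (cut (n := 1) 1 le_rfl) y = G.map (cut (n := 1) 0 (Nat.zero_le 1)) y := by
  obtain ⟨i, j, hij, hji⟩ := exists_inversion hx
  -- Block `i` has length one and all others are empty, so the relation takes place in `G_1`.
  have h : ∑ l, (if l = i then 1 else 0) = 1 := by simp
  have key := hG.map_mu_mul_map_rho (fun l => if l = i then 1 else 0) h x j (if_neg hij.ne')
    y _ rfl (by simp [hij.ne'])
  rw [eq_cut (rho _ h j _) 1 le_rfl (by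
      rw [vec_rho_zero, Finset.sum_ite_eq', if_pos (by simpa using hij)]),
    eq_cut (rho _ _ (G.perm x j) _) 0 (Nat.zero_le 1) (by
      rw [vec_rho_zero]
      refine Finset.sum_eq_zero fun l hl => if_neg fun hli => ?_
      have hl := (Finset.mem_filter.1 hl).2
      rw [Equiv.Perm.inv_eq_iff_eq] at hli
      exact absurd (hli ▸ hl) hji.not_gt)] at key
  rw [hG.commute_one] at key
  exact mul_right_cancel key

/-- Any cut factors through some `ρ_i` to `⟪1⟫`, and moving `x` past `ρ_i*` replaces `i` by `x(i)`.
If `x` acts trivially on points, nothing changes; otherwise `map_cut_eq` makes all cuts pull `y`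
back to the same element, and the index is irrelevant. -/
theorem IsTame.map_zero_mul {G : CrossedIntervalGroup.{u}} (hG : G.IsTame) {n : ℕ} (hn : 0 < n)
    (φ : (⟨n⟩ : Nabla) ⟶ ⟨0⟩) (y : G.obj ⟨0⟩) (x : G.obj ⟨n⟩) :
    G.map φ y * x = x * G.map φ y := by
  have h : ∑ _i : Fin n, 1 = n := by simp
  obtain ⟨i, s, rfl⟩ : ∃ i s, φ = rho (fun _ => 1) h i rfl ≫ s := by
    have hle := vec_add_le (isInert_zero φ)
    rcases Nat.lt_or_ge (vec φ 0) n with ha | ha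
    · exact ⟨⟨_, ha⟩, _, (eq_cut φ _ ha.le rfl).trans (rho_comp_cut_zero h ⟨_, ha⟩).symm⟩
    -- The cut behind all points does not precede any point; it is the cut after the last one. The
    -- last point exists because `0 < n`.
    · exact ⟨⟨n - 1, by omega⟩, _, (eq_cut φ _ (by dsimp only; omega) (by dsimp only; omega)).trans
        (rho_comp_cut_one h ⟨n - 1, by omega⟩).symm⟩
  rw [G.map_comp]
  by_cases hx : G.perm x = 1
  · rw [hG.mul_map_rho h x i, hx]
    rfl
  have hy := hG.map_cut_eq hx y
  have hs : G.map s y = G.map (cut (n := 1) 0 (Nat.zero_le 1)) y := by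
    have hle := vec_add_le (isInert_zero s)
    rcases Nat.lt_or_ge (vec s 0) 1 with ha | ha
    · rw [eq_cut s 0 (Nat.zero_le 1) (by omega)]
    · rw [eq_cut s 1 le_rfl (by omega), hy]
  -- Induction along the chain of cuts: both cuts of `⟪1⟫` give the same element, so the cuts before
  -- and after each point agree on `y`.
  have step : ∀ (a : ℕ) (ha : a < n),
      G.map (rho (fun _ => 1) h ⟨a, ha⟩ rfl) (G.map s y) = G.map (cut 0 (Nat.zero_le n)) y := by
    intro a
    induction a with
    | zero =>
      intro ha
      rw [hs, ← G.map_comp, rho_comp_cut_zero]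
    | succ a ih =>
      intro ha
      rw [← ih (by omega), hs, ← G.map_comp, rho_comp_cut_zero, ← hy, ← G.map_comp,
        rho_comp_cut_one]
  rw [hG.mul_map_rho h x i, step i i.2, step _ (G.perm x i).2]

end CrossedGroup

/-! ### `Ψ̂(𝒢)` is tame, operadic and over `𝔖`. -/

namespace GroupOperad

open Nabla CrossedGroup

variable (X : GroupOperad.{u})

theorem perm_toCrossed {n : ℕ} (x : X.obj n) :
    CrossedGroup.perm X.toCrossed (n := n) x = X.perm x :=
  perm_eq_of_act X.toCrossed (n := n) x (X.perm x) fun _ => rfl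

theorem pull_rho_eq {n m l : ℕ} (k : Fin n → ℕ) (h : ∑ i, k i = m) (i : Fin n) (hl : k i = l)
    (y : X.obj l) (z : ∀ j, X.obj (k j)) (hz : HEq (z i) y) (hz' : ∀ j, j ≠ i → z j = 1) :
    X.pull (rho k h i hl) y = X.comp k h 1 z := by
  subst hl
  obtain rfl := eq_of_heq hz
  refine (X.pull_rho k h i (z i)).trans ?_
  congr 1
  funext j
  by_cases hj : j = i
  · subst hj; simp
  · rw [Pi.mulSingle_eq_of_ne hj, hz' j hj]

/-- The interchange law for the factorization `(x·e; e·y_i)`, whose right factor permutes nothing.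
-/
theorem comp_eq_mul {n m : ℕ} (k : Fin n → ℕ) (h : ∑ i, k i = m) (x : X.obj n)
    (y : ∀ i, X.obj (k i)) : X.comp k h x y = X.comp k h x 1 * X.comp k h 1 y := by
  have aux : ∀ (τ : Equiv.Perm (Fin n)) (hτ : τ = 1) (h2 : ∑ i, k (τ⁻¹ i) = m),
      X.comp (fun i => k (τ⁻¹ i)) h2 x 1 = X.comp k h x 1 := by
    rintro τ rfl h2
    rfl
  have := X.comp_mul k h x 1 1 y
  rw [mul_one, one_mul] at this
  rw [this]
  congr 1
  exact aux _ (map_one X.perm) _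

theorem isTame_toCrossed : X.toCrossed.IsTame := by
  intro n m k h x i y
  change X.obj n at x
  change X.obj (k i) at y
  -- The permutation read off from the action on points equals the operadic one, but not by
  -- definition. A free `σ` allows the exchange although block lengths, and hence types, depend on
  -- it.
  suffices H : ∀ (σ : Equiv.Perm (Fin n)) (_ : X.perm x = σ) (h1 : ∑ j, k (σ⁻¹ j) = m)
      (h2 : k (σ⁻¹ (σ i)) = k i), X.pull (mu k h) x * X.pull (rho k h i rfl) y =
        X.pull (rho (fun j => k (σ⁻¹ j)) h1 (σ i) h2) y * X.pull (mu k h) x from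
    H _ (X.perm_toCrossed x).symm _ _
  rintro _ rfl h1 h2
  -- The opposite splitting `(e·x; y·e)`: here the left factor receives its arguments permuted by
  -- `x`, which moves `y` to the position `x(i)`.
  have e1 := X.comp_mul k h 1 x (Pi.mulSingle (M := fun i => X.obj (k i)) i y) 1
  rw [one_mul, mul_one] at e1
  have aux : ∀ i', i' = i → HEq (Pi.mulSingle (M := fun i => X.obj (k i)) i y i') y := by
    rintro _ rfl
    rw [Pi.mulSingle_eq_same]
  rw [pull_mu, pull_rho, ← comp_eq_mul, e1]
  congr 1
  have hz : ∀ j, j ≠ X.perm x i →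
      Pi.mulSingle (M := fun i => X.obj (k i)) i y ((X.perm x)⁻¹ j) = 1 := fun j hj =>
    Pi.mulSingle_eq_of_ne (fun h => hj (by rw [← h]; exact (Equiv.apply_symm_apply _ _).symm)) _
  exact (X.pull_rho_eq (fun j => k ((X.perm x)⁻¹ j)) h1 (X.perm x i) h2 y
    (fun j => Pi.mulSingle (M := fun i => X.obj (k i)) i y ((X.perm x)⁻¹ j))
    (aux _ (Equiv.symm_apply_apply (X.perm x) i)) hz).symm

theorem commute_pull_rho {n m : ℕ} (k : Fin n → ℕ) (h : ∑ i, k i = m) {i j : Fin n} (hij : i ≠ j)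
    (x : X.obj (k i)) (y : X.obj (k j)) :
    X.pull (rho k h i rfl) x * X.pull (rho k h j rfl) y =
      X.pull (rho k h j rfl) y * X.pull (rho k h i rfl) x := by
  rw [pull_rho, pull_rho, ← comp_one_mul, ← comp_one_mul,
    (Pi.mulSingle_commute (f := fun i => X.obj (k i)) hij x y).eq]

theorem commute_pull_of_le {n k₁ k₂ : ℕ} {ρ₁ : (⟨n⟩ : Nabla) ⟶ ⟨k₁⟩} {ρ₂ : (⟨n⟩ : Nabla) ⟶ ⟨k₂⟩}
    (h₁ : IsInert ρ₁) (h₂ : IsInert ρ₂) (hle : vec ρ₁ 0 + k₁ ≤ vec ρ₂ 0)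
    (x₁ : X.obj k₁) (x₂ : X.obj k₂) :
    X.pull ρ₁ x₁ * X.pull ρ₂ x₂ = X.pull ρ₂ x₂ * X.pull ρ₁ x₁ := by
  have hle₂ := vec_add_le h₂
  obtain ⟨b, hb⟩ := Nat.exists_eq_add_of_le hle
  obtain ⟨c, hc⟩ := Nat.exists_eq_add_of_le hle₂
  -- Five blocks: before the first interval, the first interval, the gap, the second interval, and
  -- the rest. The two morphisms are `ρ` for the blocks with indices 1 and 3.
  have h : ∑ i, (![vec ρ₁ 0, k₁, b, k₂, c] : Fin 5 → ℕ) i = n := by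
    rw [Fin.sum_univ_five]
    change vec ρ₁ 0 + k₁ + b + k₂ + c = n
    omega
  have e1 : Finset.univ.filter (fun j : Fin 5 => j < 1) = {0} := rfl
  have e3 : Finset.univ.filter (fun j : Fin 5 => j < 3) = {0, 1, 2} := rfl
  rw [h₁.eq_rho ![vec ρ₁ 0, k₁, b, k₂, c] h 1 rfl (by rw [e1, Finset.sum_singleton]; rfl),
    h₂.eq_rho ![vec ρ₁ 0, k₁, b, k₂, c] h 3 rfl (by
      rw [e3, Finset.sum_insert (by decide), Finset.sum_pair (by decide)]
      change _ = vec ρ₁ 0 + (k₁ + b)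
      omega)]
  exact X.commute_pull_rho ![vec ρ₁ 0, k₁, b, k₂, c] h (i := 1) (j := 3) (by decide) x₁ x₂

theorem permAct_inert {n k : ℕ} {ρ : (⟨n⟩ : Nabla) ⟶ ⟨k⟩} (hρ : IsInert ρ)
    (σ : Equiv.Perm (Fin k)) : permAct (b := ⟨k⟩) σ ρ = ρ := by
  rw [isInert_iff_vec] at hρ
  refine hom_ext_vec fun j => ?_
  rw [vec_permAct, ext_inv]
  rcases mid_cases (n := k) j with rfl | rfl | ⟨i, rfl⟩
  · rw [ext_zero]
  · rw [ext_last]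
  · rw [ext_mid]
    exact (hρ _).trans (hρ _).symm

/-- A cut inside the interval of `ρ` factors through `ρ`, and `ρ*` is a homomorphism. The claim thus
descends to `𝒢(k)` with `k > 0`, where elements pulled back from `𝒢(0)` are central. -/
theorem commute_pull_zero {n k : ℕ} (φ : (⟨n⟩ : Nabla) ⟶ ⟨0⟩) {ρ : (⟨n⟩ : Nabla) ⟶ ⟨k⟩}
    (hρ : IsInert ρ) (h1 : vec ρ 0 < vec φ 0) (h2 : vec φ 0 < vec ρ 0 + k)
    (y : X.obj 0) (x : X.obj k) :
    X.pull φ y * X.pull ρ x = X.pull ρ x * X.pull φ y := by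
  have hφ : φ = ρ ≫ cut (vec φ 0 - vec ρ 0) (by omega) := by
    refine hom_ext fun p => Fin.ext ?_
    rw [fn_comp, (isInert_zero φ).fn_val]
    erw [fn_cut_val, hρ.fn_val]
    omega
  have e : X.pull φ y = X.pull ρ (X.pull (cut (n := k) (vec φ 0 - vec ρ 0) (by omega)) y) := by
    conv_lhs => rw [hφ]
    exact X.pull_comp _ _ _
  have hm : ∀ z z' : X.obj k, X.pull ρ (z * z') = X.pull ρ z * X.pull ρ z' := fun z z' => by
    have := X.pull_mul ρ z z'
    rw [permAct_inert hρ] at this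
    exact this
  rw [e, ← hm, ← hm]
  congr 1
  exact IsTame.map_zero_mul X.isTame_toCrossed (n := k) (by omega) _ y x

theorem isOperadic_toCrossed : X.toCrossed.IsOperadic where
  act_inert ρ hρ x := permAct_inert hρ _
  commute {n k₁ k₂} ρ₁ ρ₂ h₁ h₂ h x₁ x₂ := by
    change X.pull ρ₁ x₁ * X.pull ρ₂ x₂ = X.pull ρ₂ x₂ * X.pull ρ₁ x₁
    change X.obj k₁ at x₁
    change X.obj k₂ at x₂
    rcases Nat.lt_or_ge (vec ρ₂ 0) (vec ρ₁ 0 + k₁) with hlt₁ | hle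
    swap
    · exact X.commute_pull_of_le h₁ h₂ hle x₁ x₂
    rcases Nat.lt_or_ge (vec ρ₁ 0) (vec ρ₂ 0 + k₂) with hlt₂ | hle
    swap
    · exact (X.commute_pull_of_le h₂ h₁ hle x₂ x₁).symm
    have hle₁ := vec_add_le h₁
    have hle₂ := vec_add_le h₂
    rw [dissociated_iff] at h
    -- Neither interval ends before the other begins. If both were nonempty, this point would lie in
    -- both, against dissociation; hence one target is `⟪0⟫`.
    have h3 := h (⟨max (vec ρ₁ 0) (vec ρ₂ 0) + 1, by omega⟩ : Fin (n + 2))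
    simp only [← Fin.val_inj] at h3
    rw [h₁.fn_val, h₂.fn_val] at h3
    change (_ = 0 ∨ _ = k₁ + 1) ∨ (_ = 0 ∨ _ = k₂ + 1) at h3
    dsimp only at h3
    rcases Nat.eq_zero_or_pos k₁ with rfl | hk₁
    · exact X.commute_pull_zero ρ₁ h₂ (by omega) (by omega) x₁ x₂
    · obtain rfl : k₂ = 0 := by omega
      exact (X.commute_pull_zero ρ₂ h₁ (by omega) (by omega) x₂ x₁).symm

/-- The map `Ψ̂(𝒢) → 𝔖`. -/
def toCrossedSymm : CrossedGroup.Hom X.toCrossed symmCrossed :=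
  GroupOperad.Hom.toCrossed
    { toHom := X.toSymm
      app_mul := X.toSymm_mul
      app_toSymm := fun _ => rfl }

end GroupOperad

/-! ### Necessity: transport from `Ψ̂(𝒢)` to its isomorphic copies. -/

open CrossedGroup in
theorem isOperadic_isTame_of_essImage {G : CrossedIntervalGroup.{u}} (h : PsiHat.{u}.essImage G) :
    G.IsOperadic ∧ G.IsTame ∧ G.LiesOverSymm := by
  obtain ⟨X, ⟨e⟩⟩ := h
  have hg : ∀ a, Function.Injective (CrossedGroup.Hom.app e.inv a) := fun a =>
    Function.LeftInverse.injective (g := CrossedGroup.Hom.app e.hom a) fun x =>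
      congrFun (congrFun (congrArg CrossedGroup.Hom.app e.inv_hom_id) a) x
  refine ⟨X.isOperadic_toCrossed.of_injective e.inv hg, IsTame.of_injective X.isTame_toCrossed e.inv hg,
    ⟨?_⟩⟩
  exact
    { app := fun a x => X.toCrossedSymm.app a (CrossedGroup.Hom.app e.inv a x)
      app_map := fun φ x => by rw [CrossedGroup.Hom.app_map]; exact X.toCrossedSymm.app_map _ _
      app_mul := fun x y => by rw [CrossedGroup.Hom.app_mul]; exact X.toCrossedSymm.app_mul _ _
      act_app := fun x φ => (X.toCrossedSymm.act_app _ φ).trans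
        (CrossedGroup.Hom.act_app e.inv x φ) }

/-! ### Block products in an operadic crossed interval group. -/

namespace CrossedGroup

open Nabla

variable {G : CrossedIntervalGroup.{u}}

theorem map_one' {A : Type*} [Category A] (G : CrossedGroup.{u} A) {a b : A} (φ : b ⟶ a) :
    G.map φ 1 = 1 := by
  have h := G.map_mul φ 1 1
  rw [mul_one, G.one_act] at h
  exact left_eq_mul.1 h

/-- The elements `t` such that `φ` and `φᵗ` pull `b` back to the same element, for all `φ`. -/
def pullStabilizer (G : CrossedIntervalGroup.{u}) {n : ℕ} (b : G.obj ⟨n⟩) :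
    Submonoid (G.obj ⟨n⟩) where
  carrier := {t | ∀ (a : Nabla) (φ : a ⟶ ⟨n⟩), G.map (G.act t φ) b = G.map φ b}
  one_mem' _ φ := by rw [G.one_act]
  mul_mem' ht ht' _ φ := by rw [G.mul_act, ht, ht']

theorem mem_pullStabilizer {n : ℕ} {b t : G.obj ⟨n⟩} :
    t ∈ G.pullStabilizer b ↔ ∀ (a : Nabla) (φ : a ⟶ ⟨n⟩), G.map (G.act t φ) b = G.map φ b :=
  Iff.rfl

/-- The rule `φ*(bt) = (φᵗ)*(b) φ*(t)` loses its twist when every later factor stabilizes the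
pullbacks of the earlier ones. -/
theorem map_list_prod {n : ℕ} {a : Nabla} (φ : a ⟶ ⟨n⟩) (L : List (G.obj ⟨n⟩))
    (hL : L.Pairwise fun b t => t ∈ G.pullStabilizer b) :
    G.map φ L.prod = (L.map (G.map φ)).prod := by
  induction L with
  | nil => exact G.map_one' φ
  | cons b L ih =>
    rw [List.pairwise_cons] at hL
    rw [List.prod_cons, G.map_mul, ih hL.2, List.map_cons, List.prod_cons,
      mem_pullStabilizer.1 ((G.pullStabilizer b).list_prod_mem hL.1)]

theorem IsOperadic.map_mul (hG : G.IsOperadic) {n k : ℕ} (ρ : (⟨n⟩ : Nabla) ⟶ ⟨k⟩)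
    (hρ : IsInert ρ) (x y : G.obj ⟨k⟩) : G.map ρ (x * y) = G.map ρ x * G.map ρ y := by
  rw [CrossedGroup.map_mul, hG.act_inert ρ hρ]

/-- The map `ρ_i^*` as a homomorphism. -/
def IsOperadic.rhoHom (hG : G.IsOperadic) {n m : ℕ} (k : Fin n → ℕ) (h : ∑ i, k i = m)
    (i : Fin n) : G.obj ⟨k i⟩ →* G.obj ⟨m⟩ :=
  MonoidHom.mk' (G.map (rho k h i rfl)) (hG.map_mul _ (isInert_rho k h i rfl))

theorem IsOperadic.commute_rho (hG : G.IsOperadic) {n m : ℕ} (k : Fin n → ℕ) (h : ∑ i, k i = m) :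
    Pairwise fun i j => ∀ x y, Commute (hG.rhoHom k h i x) (hG.rhoHom k h j y) :=
  fun i j hij x y => hG.commute _ _ (isInert_rho k h i rfl) (isInert_rho k h j rfl)
    (dissociated_rho k h hij) x y

/-- The homomorphism `(x₁, …, xₙ) ↦ ρ₁*(x₁) ⋯ ρₙ*(xₙ)`. -/
def IsOperadic.blockHom (hG : G.IsOperadic) {n m : ℕ} (k : Fin n → ℕ) (h : ∑ i, k i = m) :
    (∀ i, G.obj ⟨k i⟩) →* G.obj ⟨m⟩ :=
  MonoidHom.noncommPiCoprod (hG.rhoHom k h) (hG.commute_rho k h)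

theorem IsOperadic.blockHom_apply (hG : G.IsOperadic) {n m : ℕ} (k : Fin n → ℕ)
    (h : ∑ i, k i = m) (y : ∀ i, G.obj ⟨k i⟩) :
    hG.blockHom k h y = (List.ofFn fun i => G.map (rho k h i rfl) (y i)).prod := by
  rw [List.ofFn_eq_map]
  exact Multiset.noncommProd_coe ((List.finRange n).map fun i => hG.rhoHom k h i (y i)) fun a ha b hb hab => by
    obtain ⟨i, -, rfl⟩ := List.mem_map.1 (Multiset.mem_coe.1 ha)
    obtain ⟨j, -, rfl⟩ := List.mem_map.1 (Multiset.mem_coe.1 hb)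
    exact hG.commute_rho k h (fun hij => hab (by rw [hij])) _ _

theorem IsOperadic.blockHom_single (hG : G.IsOperadic) {n m : ℕ} (k : Fin n → ℕ)
    (h : ∑ i, k i = m) (i : Fin n) (y : G.obj ⟨k i⟩) :
    hG.blockHom k h (Pi.mulSingle (M := fun i => G.obj ⟨k i⟩) i y) = G.map (rho k h i rfl) y :=
  MonoidHom.noncommPiCoprod_mulSingle (hG.rhoHom k h) i y

/-- A form of `blockHom_single` for families that are not literally a `Pi.mulSingle`, such as
reindexed ones; the heterogeneous equality absorbs the change of block length. -/
theorem IsOperadic.blockHom_eq (hG : G.IsOperadic) {n m l : ℕ} (k : Fin n → ℕ)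
    (h : ∑ i, k i = m) (i : Fin n) (hl : k i = l) (y : G.obj ⟨l⟩) (z : ∀ j, G.obj ⟨k j⟩)
    (hz : HEq (z i) y) (hz' : ∀ j, j ≠ i → z j = 1) :
    hG.blockHom k h z = G.map (rho k h i hl) y := by
  subst hl
  obtain rfl := eq_of_heq hz
  rw [← hG.blockHom_single]
  congr 1
  funext j
  by_cases hj : j = i
  · subst hj; simp
  · rw [Pi.mulSingle_eq_of_ne hj, hz' j hj]

theorem IsOperadic.operadComp_eq (hG : G.IsOperadic) {n m : ℕ} (k : Fin n → ℕ) (h : ∑ i, k i = m)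
    (x : G.obj ⟨n⟩) (y : ∀ i, G.obj ⟨k i⟩) :
    G.operadComp k h x y = G.map (mu k h) x * hG.blockHom k h y := by
  rw [hG.blockHom_apply]; rfl

theorem IsOperadic.map_mu_mul_blockHom (hG : G.IsOperadic) (ht : G.IsTame) {n m : ℕ}
    (k : Fin n → ℕ) (h : ∑ i, k i = m) (x : G.obj ⟨n⟩) (y : ∀ i, G.obj ⟨k i⟩) :
    G.map (mu k h) x * hG.blockHom k h y =
      hG.blockHom (fun j => k ((G.perm x)⁻¹ j)) (sum_perm h (G.perm x))
        (fun j => y ((G.perm x)⁻¹ j)) * G.map (mu k h) x := by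
  set σ := G.perm x with hσ
  -- Conjugation by `μ_k*(x)` after the block product, and the block product of the permuted family,
  -- are both homomorphisms. They agree on single coordinates by tameness, hence everywhere.
  let F : (∀ i, G.obj ⟨k i⟩) →* G.obj ⟨m⟩ :=
    (MulAut.conj (G.map (mu k h) x)).toMonoidHom.comp (hG.blockHom k h)
  let F' : (∀ i, G.obj ⟨k i⟩) →* G.obj ⟨m⟩ :=
    MonoidHom.mk' (fun y => hG.blockHom (fun j => k (σ⁻¹ j)) (sum_perm h σ) fun j => y (σ⁻¹ j))
      fun a b => (hG.blockHom (fun j => k (σ⁻¹ j)) (sum_perm h σ)).map_mul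
        (fun j => a (σ⁻¹ j)) (fun j => b (σ⁻¹ j))
  have hF : F = F' := by
    refine MonoidHom.pi_ext fun i y => ?_
    change G.map (mu k h) x * hG.blockHom k h (Pi.mulSingle i y) * (G.map (mu k h) x)⁻¹ =
      hG.blockHom (fun j => k (σ⁻¹ j)) (sum_perm h σ) fun j =>
        Pi.mulSingle (M := fun i => G.obj ⟨k i⟩) i y (σ⁻¹ j)
    rw [mul_inv_eq_iff_eq_mul, hG.blockHom_single,
      ht.map_mu_mul_map_rho k h x i rfl y σ rfl (by simp)]
    congr 1
    have aux : ∀ i', i' = i → HEq (Pi.mulSingle (M := fun i => G.obj ⟨k i⟩) i y i') y := by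
      rintro _ rfl
      rw [Pi.mulSingle_eq_same]
    have hz : ∀ j, j ≠ σ i → Pi.mulSingle (M := fun i => G.obj ⟨k i⟩) i y (σ⁻¹ j) = 1 := fun j hj =>
      Pi.mulSingle_eq_of_ne (fun h => hj (by rw [← h]; exact (Equiv.apply_symm_apply _ _).symm)) _
    exact (hG.blockHom_eq (fun j => k (σ⁻¹ j)) (sum_perm h σ) (σ i) (by simp) y
      (fun j => Pi.mulSingle (M := fun i => G.obj ⟨k i⟩) i y (σ⁻¹ j))
      (aux _ (Equiv.symm_apply_apply σ i)) hz).symm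
  exact mul_inv_eq_iff_eq_mul.1 (DFunLike.congr_fun hF y)

theorem IsOperadic.blockHom_blockHom (hG : G.IsOperadic) {n m r : ℕ} (k : Fin n → ℕ)
    (h : ∑ i, k i = m) (l : Fin m → ℕ) (h' : ∑ p, l p = r)
    (h'' : ∑ i, ∑ s, l (blk k h i s) = r) (z : ∀ p, G.obj ⟨l p⟩) :
    hG.blockHom (fun i => ∑ s, l (blk k h i s)) h''
      (fun i => hG.blockHom (fun s => l (blk k h i s)) rfl fun s => z (blk k h i s)) =
      hG.blockHom l h' z := by
  let F : (∀ p, G.obj ⟨l p⟩) →* G.obj ⟨r⟩ :=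
    (hG.blockHom (fun i => ∑ s, l (blk k h i s)) h'').comp
      (MonoidHom.pi fun i => (hG.blockHom (fun s => l (blk k h i s)) rfl).comp
        (MonoidHom.pi fun s => Pi.evalMonoidHom (fun p => G.obj ⟨l p⟩) (blk k h i s)))
  -- Again a comparison of homomorphisms on one coordinate, where it is the relation `rho_comp_rho`.
  have hF : F = hG.blockHom l h' := by
    refine MonoidHom.pi_ext fun p x => ?_
    obtain ⟨i, s, rfl⟩ := blk_surj k h p
    have inj : ∀ j t, blk k h j t = blk k h i s → (⟨j, t⟩ : Σ i, Fin (k i)) = ⟨i, s⟩ :=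
      fun j t hjt => (blkEquiv k h).injective hjt
    rw [hG.blockHom_single, ← rho_comp_rho k h l h' h'', G.map_comp]
    change hG.blockHom (fun i => ∑ s, l (blk k h i s)) h'' (fun i =>
      hG.blockHom (fun s => l (blk k h i s)) rfl fun s =>
        Pi.mulSingle (M := fun p => G.obj ⟨l p⟩) _ x (blk k h i s)) = _
    refine hG.blockHom_eq (fun i => ∑ s, l (blk k h i s)) h'' i rfl _ _ (heq_of_eq ?_)
      fun j hj => ?_
    · refine hG.blockHom_eq (fun s => l (blk k h i s)) rfl s rfl _ _ (heq_of_eq ?_)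
        fun t ht => ?_
      · exact Pi.mulSingle_eq_same (M := fun p => G.obj ⟨l p⟩) _ _
      · refine Pi.mulSingle_eq_of_ne (M := fun p => G.obj ⟨l p⟩) (fun hit => ht ?_) _
        simpa using inj _ _ hit
    · refine Eq.trans ?_ (hG.blockHom (fun s => l (blk k h j s)) rfl).map_one
      congr 1
      funext t
      refine Pi.mulSingle_eq_of_ne (M := fun p => G.obj ⟨l p⟩) (fun hit => hj ?_) _
      exact congrArg Sigma.fst (inj _ _ hit)
  exact DFunLike.congr_fun hF z

/-! ## Crossed interval groups over `𝔖` -/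

/-- The permutation underlying the image of `x` in `𝔖`. -/
def Hom.sym (π : Hom G symmCrossed) {n : ℕ} (x : G.obj ⟨n⟩) : Equiv.Perm (Fin n) :=
  π.app ⟨n⟩ x

variable (π : Hom G symmCrossed)

theorem Hom.sym_one {n : ℕ} : π.sym (1 : G.obj ⟨n⟩) = 1 := by
  have h := π.app_mul (1 : G.obj ⟨n⟩) 1
  rw [mul_one] at h
  exact left_eq_mul.1 h

theorem Hom.sym_mul {n : ℕ} (x y : G.obj ⟨n⟩) : π.sym (x * y) = π.sym x * π.sym y :=
  π.app_mul x y

theorem Hom.act_eq {a : Nabla} {n : ℕ} (x : G.obj ⟨n⟩) (φ : a ⟶ ⟨n⟩) :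
    G.act x φ = permAct (b := ⟨n⟩) (π.sym x) φ :=
  (π.act_app x φ).symm

theorem Hom.perm_eq {n : ℕ} (x : G.obj ⟨n⟩) : G.perm x = π.sym x :=
  perm_eq_of_act G x _ fun _ => π.act_eq x _

theorem Hom.sym_map_mu {n m : ℕ} (k : Fin n → ℕ) (h : ∑ i, k i = m) (x : G.obj ⟨n⟩) :
    π.sym (G.map (mu k h) x) = permComp k h (π.sym x) 1 :=
  (π.app_map (mu k h) x).trans (GroupOperad.symm.pull_mu k h (π.sym x))

theorem Hom.sym_map_rho {n m : ℕ} (k : Fin n → ℕ) (h : ∑ i, k i = m) (i : Fin n)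
    (y : G.obj ⟨k i⟩) :
    π.sym (G.map (rho k h i rfl) y) =
      permComp k h 1 (Pi.mulSingle (M := fun i => Equiv.Perm (Fin (k i))) i (π.sym y)) :=
  (π.app_map (rho k h i rfl) y).trans (GroupOperad.symm.pull_rho k h i (π.sym y))

theorem Hom.sym_blockHom (hG : G.IsOperadic) {n m : ℕ} (k : Fin n → ℕ) (h : ∑ i, k i = m)
    (y : ∀ i, G.obj ⟨k i⟩) :
    π.sym (hG.blockHom k h y) = permComp k h 1 fun i => π.sym (y i) := by
  let F : (∀ i, G.obj ⟨k i⟩) →* Equiv.Perm (Fin m) :=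
    (MonoidHom.mk' π.sym π.sym_mul).comp (hG.blockHom k h)
  let F' : (∀ i, G.obj ⟨k i⟩) →* Equiv.Perm (Fin m) :=
    MonoidHom.mk' (fun y => permComp k h 1 fun i => π.sym (y i)) fun a b => by
      simp only [Pi.mul_apply, π.sym_mul]
      exact GroupOperad.symm.comp_one_mul k h (fun i => π.sym (a i)) fun i => π.sym (b i)
  have hF : F = F' := by
    refine MonoidHom.pi_ext fun i y => ?_
    refine (congrArg π.sym (hG.blockHom_single k h i y)).trans ((π.sym_map_rho k h i y).trans ?_)
    refine congrArg (permComp k h 1) (funext fun j => ?_)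
    by_cases hj : j = i
    · subst hj; simp
    · rw [Pi.mulSingle_eq_of_ne hj, Pi.mulSingle_eq_of_ne hj, π.sym_one]
  exact DFunLike.congr_fun hF y

theorem Hom.sym_operadComp (hG : G.IsOperadic) {n m : ℕ} (k : Fin n → ℕ) (h : ∑ i, k i = m)
    (x : G.obj ⟨n⟩) (y : ∀ i, G.obj ⟨k i⟩) :
    π.sym (G.operadComp k h x y) = permComp k h (π.sym x) fun i => π.sym (y i) := by
  rw [hG.operadComp_eq, π.sym_mul, π.sym_map_mu, π.sym_blockHom hG]
  exact (GroupOperad.symm.comp_eq_mul k h (π.sym x) fun i => π.sym (y i)).symm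

/-! ### Block permutations do not disturb pullbacks; associativity. -/

theorem permComp_one_blk {n m : ℕ} (k : Fin n → ℕ) (h : ∑ i, k i = m)
    (τ : ∀ i, Equiv.Perm (Fin (k i))) (i : Fin n) (s : Fin (k i)) :
    permComp k h 1 τ (blk k h i s) = blk k h i (τ i s) := by
  apply Fin.ext
  rw [permComp_val, blk_val]
  rfl

theorem fn_mu_ext_permComp {n m : ℕ} (k : Fin n → ℕ) (h : ∑ i, k i = m)
    (τ : ∀ i, Equiv.Perm (Fin (k i))) (p : Fin (m + 2)) :
    fn (mu k h) (ext (permComp k h 1 τ) p) = fn (mu k h) p := by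
  rcases mid_cases p with rfl | rfl | ⟨q, rfl⟩
  · rw [ext_zero]
  · rw [ext_last]
  · obtain ⟨i, s, rfl⟩ := blk_surj k h q
    rw [ext_mid, permComp_one_blk, fn_mu_blk, fn_mu_blk]

theorem fn_rho_ext_permComp {n m : ℕ} (k : Fin n → ℕ) (h : ∑ i, k i = m)
    (τ : ∀ i, Equiv.Perm (Fin (k i))) (j : Fin n) (hj : τ j = 1) (p : Fin (m + 2)) :
    fn (rho k h j rfl) (ext (permComp k h 1 τ) p) = fn (rho k h j rfl) p := by
  rcases mid_cases p with rfl | rfl | ⟨q, rfl⟩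
  · rw [ext_zero]
  · rw [ext_last]
  · obtain ⟨i, s, rfl⟩ := blk_surj k h q
    rw [ext_mid, permComp_one_blk]
    rcases lt_trichotomy i j with hi | rfl | hi
    · rw [fn_rho_blk_of_lt _ _ _ hi, fn_rho_blk_of_lt _ _ _ hi]
    · rw [hj]; rfl
    · rw [fn_rho_blk_of_gt _ _ _ hi, fn_rho_blk_of_gt _ _ _ hi]

theorem Hom.act_blockHom_comp_mu (π : Hom G symmCrossed) (hG : G.IsOperadic) {n m : ℕ} (k : Fin n → ℕ)
    (h : ∑ i, k i = m) (y : ∀ i, G.obj ⟨k i⟩) {a : Nabla} (ψ : a ⟶ ⟨m⟩) :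
    G.act (hG.blockHom k h y) ψ ≫ mu k h = ψ ≫ mu k h := by
  rw [π.act_eq, π.sym_blockHom hG]
  exact permAct_comp_of_fixed ψ (mu k h) _ (fn_mu_ext_permComp k h _)

/-- Elements of the image of `ρ_j*` permute points of block `j` only, and for `i ≠ j` the morphism
`ρ_i` is constant on that block. The factors therefore do not twist one another. -/
theorem Hom.map_blockHom (π : Hom G symmCrossed) (hG : G.IsOperadic) {n m : ℕ} (k : Fin n → ℕ)
    (h : ∑ i, k i = m) (y : ∀ i, G.obj ⟨k i⟩) {a : Nabla} (ψ : a ⟶ ⟨m⟩) :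
    G.map ψ (hG.blockHom k h y) =
      (List.ofFn fun i => G.map (ψ ≫ rho k h i rfl) (y i)).prod := by
  rw [hG.blockHom_apply, map_list_prod, List.map_ofFn]
  · congr 2
    funext i
    exact (G.map_comp _ _ _).symm
  · rw [List.pairwise_ofFn]
    intro i j hij
    rw [mem_pullStabilizer]
    intro b φ
    rw [← G.map_comp, ← G.map_comp, π.act_eq, π.sym_map_rho]
    congr 1
    refine permAct_comp_of_fixed φ _ _ (fn_rho_ext_permComp k h _ i ?_)
    exact Pi.mulSingle_eq_of_ne hij.ne _

theorem Hom.map_mu_blockHom (π : Hom G symmCrossed) (hG : G.IsOperadic) {n m r : ℕ} (k : Fin n → ℕ)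
    (h : ∑ i, k i = m) (l : Fin m → ℕ) (h' : ∑ p, l p = r)
    (h'' : ∑ i, ∑ s, l (blk k h i s) = r) (y : ∀ i, G.obj ⟨k i⟩) :
    G.map (mu l h') (hG.blockHom k h y) =
      hG.blockHom (fun i => ∑ s, l (blk k h i s)) h''
        fun i => G.map (mu (fun s => l (blk k h i s)) rfl) (y i) := by
  rw [π.map_blockHom hG, hG.blockHom_apply]
  congr 2
  funext i
  rw [mu_comp_rho k h l h' h'', G.map_comp]

theorem Hom.operadComp_assoc (π : Hom G symmCrossed) (hG : G.IsOperadic) {n m r : ℕ} (k : Fin n → ℕ)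
    (h : ∑ i, k i = m) (l : Fin m → ℕ) (h' : ∑ p, l p = r)
    (h'' : ∑ i, ∑ s, l (blk k h i s) = r) (x : G.obj ⟨n⟩) (y : ∀ i, G.obj ⟨k i⟩)
    (z : ∀ p, G.obj ⟨l p⟩) :
    G.operadComp l h' (G.operadComp k h x y) z =
      G.operadComp (fun i => ∑ s, l (blk k h i s)) h'' x
        (fun i => G.operadComp (fun s => l (blk k h i s)) rfl (y i)
          (fun s => z (blk k h i s))) := by
  have e : (fun i => G.operadComp (fun s => l (blk k h i s)) rfl (y i)
      (fun s => z (blk k h i s))) =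
      (fun i => G.map (mu (fun s => l (blk k h i s)) rfl) (y i)) *
        (fun i => hG.blockHom (fun s => l (blk k h i s)) rfl fun s => z (blk k h i s)) :=
    -- Splitting the inner compositions into their `y` and `z` parts lets `blockHom` separate them;
    -- the three kinds of factors can then be compared one at a time.
    funext fun i => hG.operadComp_eq _ _ _ _
  rw [e, hG.operadComp_eq, hG.operadComp_eq, hG.operadComp_eq, _root_.map_mul,
    hG.blockHom_blockHom k h l h', ← π.map_mu_blockHom hG k h l h', ← mul_assoc, G.map_mul,
    ← G.map_comp, π.act_blockHom_comp_mu, mu_comp_mu k h l h' h'']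

/-- The group operad `𝒪_G`. -/
def Hom.groupOperad (hG : G.IsOperadic) (ht : G.IsTame) : GroupOperad.{u} where
  obj n := G.obj ⟨n⟩
  one := (1 : G.obj ⟨1⟩)
  comp k h x y := G.operadComp k h x y
  one_comp {m} x := by
    rw [hG.operadComp_eq, G.map_one', one_mul,
      hG.blockHom_eq (fun _ : Fin 1 => m) (by simp) 0 rfl x (fun _ => x) HEq.rfl
        (fun j hj => absurd (Subsingleton.elim j 0) hj), rho_fin_one, G.map_id]
  comp_one {n} x := by
    rw [hG.operadComp_eq, mu_one, G.map_id]
    exact (congrArg (x * ·) (hG.blockHom (fun _ : Fin n => 1) _).map_one).trans (mul_one x)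
  assoc k h l h' h'' x y z := π.operadComp_assoc hG k h l h' h'' x y z
  group n := G.group ⟨n⟩
  toSymm :=
    { app := fun _ x => π.sym x
      app_one := π.sym_one
      app_comp := fun k h x y => π.sym_operadComp hG k h x y }
  toSymm_mul x y := π.sym_mul x y
  interchange {n m} k h x y xs ys := by
    suffices H : ∀ (σ : Equiv.Perm (Fin n)) (_ : G.perm y = σ) (h1 : ∑ j, k (σ⁻¹ j) = m),
        G.operadComp k h (x * y) (fun i => xs i * ys i) =
          G.operadComp (fun i => k (σ⁻¹ i)) h1 x (fun i => xs (σ⁻¹ i)) * G.operadComp k h y ys from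
      H _ (π.perm_eq y) _
    rintro _ rfl h1
    have e : (fun i => xs i * ys i) = xs * ys := rfl
    have hmu : ∀ (τ : Equiv.Perm (Fin n)) (_ : π.sym y = τ) (h2 : ∑ j, k (τ⁻¹ j) = m),
        G.act y (mu k h) = mu (fun i => k (τ⁻¹ i)) h2 := by
      rintro _ rfl h2
      rw [π.act_eq, permAct_mu]
    rw [e, hG.operadComp_eq, hG.operadComp_eq, hG.operadComp_eq, _root_.map_mul, G.map_mul,
      hmu _ (π.perm_eq y).symm h1]
    simp only [mul_assoc]
    -- After the common left factor is cancelled, what remains is to move `μ_k*(y)` past the block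
    -- product of the `xs`, which permutes that family by `y`.
    congr 1
    rw [← mul_assoc, hG.map_mu_mul_blockHom ht, mul_assoc]

/-- In `γ(e₃; e, γ(x; e, …, e), e)` the inner composition is `μ*(x)` and the outer one is `ρ*` for
the middle of three blocks. Together they are the pullback along the inert-active factorization of
`φ`. -/
theorem Hom.pull_groupOperad (hG : G.IsOperadic) (ht : G.IsTame) {a b : Nabla} (φ : a ⟶ b)
    (x : G.obj b) : (π.groupOperad hG ht).pull φ x = G.map φ x := by
  have h : ∑ i, (![vec φ 0, ∑ i, vec φ (mid i), vec φ (Fin.last _)] : Fin 3 → ℕ) i = a.len := by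
    rw [Fin.sum_univ_three]
    exact GroupOperad.sum_vec_mid φ
  have e : G.operadComp (fun i => vec φ (mid i)) rfl x (fun _ => 1) =
      G.map (mu (fun i => vec φ (mid i)) rfl) x := by
    rw [hG.operadComp_eq]
    exact (congrArg (_ * ·) (hG.blockHom _ rfl).map_one).trans (mul_one _)
  change G.operadComp _ h 1 ((π.groupOperad hG ht).tri _ _
    (G.operadComp (fun i => vec φ (mid i)) rfl x (fun _ => 1))) = _
  rw [e]
  refine (hG.operadComp_eq _ h 1 _).trans
    ((congrArg (· * _) (G.map_one' _)).trans ((one_mul _).trans ?_))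
  refine (hG.blockHom_eq _ h 1 rfl (G.map (mu (fun i => vec φ (mid i)) rfl) x) _ HEq.rfl ?_).trans ?_
  · intro j hj
    fin_cases j
    · rfl
    · exact absurd rfl hj
    · rfl
  · refine (G.map_comp _ _ x).symm.trans ?_
    exact congrArg (fun ψ => G.map ψ x) (rho_comp_mu φ h)

/-- The isomorphism `Ψ̂(𝒪_G) ≅ G`. -/
def Hom.groupOperadIso (hG : G.IsOperadic) (ht : G.IsTame) :
    PsiHat.obj (π.groupOperad hG ht) ≅ G where
  hom := show CrossedGroup.Hom _ _ from
    { app := fun _ x => x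
      app_map := fun φ x => π.pull_groupOperad hG ht φ x
      app_mul := fun _ _ => rfl
      act_app := fun x φ => π.act_eq x φ }
  inv := show CrossedGroup.Hom _ _ from
    { app := fun _ x => x
      app_map := fun φ x => (π.pull_groupOperad hG ht φ x).symm
      app_mul := fun _ _ => rfl
      act_app := fun x φ => (π.act_eq x φ).symm }
  hom_inv_id := rfl
  inv_hom_id := rfl

end CrossedGroup

end IntervalGroups

theorem mainTheorem2 (G : CrossedIntervalGroup.{u}) :
    (PsiHat.{u}.essImage G ↔ G.IsOperadic ∧ G.IsTame ∧ G.LiesOverSymm) ∧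
    (G.IsOperadic → G.IsTame → G.LiesOverSymm →
      ∃ (O : GroupOperad.{u}) (e : PsiHat.obj O ≅ G),
        ∀ (n : ℕ) (k : Fin n → ℕ) (x : O.obj n) (y : ∀ i, O.obj (k i)),
          levelMap e.hom (∑ i, k i) (O.comp k rfl x y) =
            G.operadComp k rfl (levelMap e.hom n x) (fun i => levelMap e.hom (k i) (y i))) := by
  refine ⟨⟨isOperadic_isTame_of_essImage, ?_⟩, ?_⟩
  · rintro ⟨hG, ht, ⟨π⟩⟩
    exact ⟨π.groupOperad hG ht, ⟨π.groupOperadIso hG ht⟩⟩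
  · rintro hG ht ⟨π⟩
    -- The isomorphism is the identity on elements and the composition is `operadComp` by
    -- definition, so the compatibility needs no argument.
    exact ⟨π.groupOperad hG ht, π.groupOperadIso hG ht, fun _ _ _ _ => rfl⟩
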